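/- **Theorem (Soundness for may-testing).** Let $\mathcal N_1,\mathcal N_2$ be finitary well-formed networks. If $\mathcal N_1$ is simulated by $\mathcal N_2$ (written $\mathcal N_1\lhd\mathcal N_2$), then $\mathcal N_1\sqsubseteq_{may}\mathcal N_2$. The notions are as follows. *Probability.* A sub-distribution on a set $S$ is a map $\Delta:S\to[0,1]$ with $\sum_s\Delta(s)\le 1$; it is a (full) distribution if the sum is $1$; $\overline s$ is the point distribution at $s$. The lifting $\overline{R}$ of a relation $R$ from states to sub-distributions is the smallest relation between sub-distributions with $\overline s\,\overline R\,\Theta$ whenever $s\,R\,\Theta$, and $\sum_{i\in I} p_i\Delta_i\;\overline R\;\sum_{i\in I} p_i\Theta_i$ whenever $I$ is finite, $p_i\ge0$, $\sum_i p_i\le 1$ and $\Delta_i\,\overline R\,\Theta_i$ for all $i$. A relation $R$ between states is lifted through $R^e=\{(s,\overline t): s\,R\,t\}$. In a probabilistic labelled transition system (pLTS), with transitions $s\xrightarrow{\mu}\Delta$ to full distributions, a label $\tau$ and a success predicate $\omega$, transitions are lifted to sub-distributions, and $\Delta\Rightarrow\Delta'$ (hyper-derivation) means that there are sub-distributions $\Delta_k^{\to},\Delta_k^{\times}$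 ($k\ge0$) with $\Delta=\Delta_0^\to+\Delta_0^\times$, $\Delta_k^\to\xrightarrow{\tau}\Delta_{k+1}^\to+\Delta_{k+1}^\times$, no successful state in the support of any $\Delta_k^\to$, and $\Delta'=\sum_k\Delta_k^\times$. It is an extreme derivation if every state in the support of $\Delta'$ that has a $\tau$-transition is successful. $\mathrm{Results}(\Delta)$ is the set of the numbers $\sum_{\omega(s)}\Delta'(s)$ over all extreme derivatives $\Delta'$ of $\Delta$. *The calculus.* Processes are $p::=s\mid p\oplus_r p$ ($r\in[0,1]$) and states are $s::=c!\langle e\rangle.p\mid c?(x).p\mid\omega.\mathbf 0\mid s+s\mid \mathrm{if}\ b\ \mathrm{then}\ s\ \mathrm{else}\ s\mid\tau.p\mid A\langle\tilde e\rangle\mid\mathbf 0$, relative to given definitions $A(\tilde x)\Leftarrow s$; expressions evaluate to values. A process denotes a distribution of states: $[\![s]\!]=\overline s$, $[\![p\oplus_r q]\!]=r[\![p]\!]+(1-r)[\![q]\!]$. For closed states, $c!\langle e\rangle.p\xrightarrow{c![\![e]\!]}[\![p]\!]$, $c?(x).p\xrightarrow{c?v}[\![p\{v/x\}]\!]$ for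 every value $v$, $\tau.p\xrightarrow{\tau}[\![p]\!]$; a sum has the transitions of both summands, a conditional those of the selected branch, and $A\langle\tilde e\rangle$ those of $s\{\tilde e/\tilde x\}$; $\omega.\mathbf 0$ and $\mathbf 0$ have none. System terms are $M::=n[s]\mid M\,|\,M\mid\mathbf 0$ ($s$ closed), and $\mathrm{nodes}(M)$ is the set of node names in $M$. A network $\Gamma\rhd M$ consists of a finite irreflexive directed graph $\Gamma=(\Gamma_V,\Gamma_E)$ on node names and a system term $M$ in which no node name occurs twice and $\mathrm{nodes}(M)\subseteq\Gamma_V$. Its interface is $\Gamma_V\setminus\mathrm{nodes}(M)$; $\mathrm{In}$ (resp. $\mathrm{Out}$) is the set of interface nodes with an outgoing (resp. incoming) edge. It is well-formed if every edge has an endpoint in $\mathrm{nodes}(M)$ and every isolated node is in $\mathrm{nodes}(M)$. *Intensional semantics* (with $\Delta,\Theta$ distributions). $n[s]\xrightarrow{n.c!v}n[\Delta]$ if $s\xrightarrow{c!v}\Delta$; $n[s]\xrightarrow{n.\tau}n[\Delta]$ if $s\xrightarrow{\tau}\Delta$; $n[s]\xrightarrow{m.c?v}n[\Delta]$ if $s\xrightarrow{c?v}\Delta$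 and $(m,n)\in\Gamma_E$; $n[s]\xrightarrow{m.c?v}\overline{n[s]}$ if $s$ has no $c?v$-transition or $(m,n)\notin\Gamma_E$; $\mathbf 0\xrightarrow{m.c?v}\overline{\mathbf 0}$. If $M\xrightarrow{m.\tau}\Delta$ then $M|N\xrightarrow{m.\tau}\Delta|\overline N$; if $M\xrightarrow{m.c?v}\Delta$ and $N\xrightarrow{m.c?v}\Theta$ then $M|N\xrightarrow{m.c?v}\Delta|\Theta$; if $M\xrightarrow{m.c!v}\Delta$ and $N\xrightarrow{m.c?v}\Theta$ then $M|N\xrightarrow{m.c!v}\Delta|\Theta$; the first and the last rule also hold symmetrically. Structural congruence $\equiv$ makes $(+,\mathbf 0)$ and $(|,\mathbf 0)$ commutative monoids, identifies a conditional with its selected branch and $A\langle\tilde e\rangle$ with $s\{\tilde e/\tilde x\}$, and extends to nodes, to networks with the same graph, and by lifting to distributions. A system term $M$, and any network $\Gamma\rhd M$, is successful if $M\equiv M'\,|\,n[\omega.\mathbf 0+s]$ for some $M',n,s$. *May-testing.* Reductions are $\Gamma\rhd M\to\Gamma\rhd\Delta$ whenever $\Gamma\rhd M\xrightarrow{m.\tau}\Delta$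 or $\Gamma\rhd M\xrightarrow{m.c!v}\Delta$. $\mathrm{Results}(\mathcal M)$ is computed from $\overline{\mathcal M}$, taking reductions as the $\tau$-transitions. The composition $(\Gamma_M\rhd M)\,\|\,(\Gamma_T\rhd T)=(\Gamma_M\cup\Gamma_T)\rhd(M|T)$ is defined iff $\mathrm{nodes}(M)\cap(\Gamma_T)_V=\emptyset$. $\mathcal M_1\sqsubseteq_{may}\mathcal M_2$ means: $\mathrm{In}(\mathcal M_1)=\mathrm{In}(\mathcal M_2)$, $\mathrm{Out}(\mathcal M_1)=\mathrm{Out}(\mathcal M_2)$, and for every well-formed network $\mathcal T$ such that $\mathcal M_1\|\mathcal T$ and $\mathcal M_2\|\mathcal T$ are defined, each $q_1\in\mathrm{Results}(\mathcal M_1\|\mathcal T)$ satisfies $q_1\le q_2$ for some $q_2\in\mathrm{Results}(\mathcal M_2\|\mathcal T)$. *Extensional actions.* Only networks $\mathcal M=\Gamma\rhd M$ that are not successful have extensional transitions, to $\Gamma\rhd\Delta$: $\tau$, if $\mathcal M\xrightarrow{m.\tau}\Delta$, or if $\mathcal M\xrightarrow{n.c!v}\Delta$ and all out-neighbours of $n$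 are in $\mathrm{nodes}(M)$; $n.c?v$, if $\mathcal M\xrightarrow{n.c?v}\Delta$ and $n\in\mathrm{In}(\mathcal M)$; $c!v\rhd\eta$, if $\mathcal M\xrightarrow{m.c!v}\Delta$ and $\eta=\{o\in\mathrm{Out}(\mathcal M):(m,o)\in\Gamma_E\}\neq\emptyset$. A network is finitary if, up to $\equiv$, only finitely many networks are reachable from it by extensional transitions and each of them has only finitely many distributions as targets of its transitions. With $\Rightarrow$ the hyper-derivations for extensional $\tau$, the weak actions are: $\stackrel{\tau}{\Longrightarrow}$ is $\Rightarrow$; $\stackrel{n.c?v}{\Longrightarrow}$ is $\Rightarrow\xrightarrow{n.c?v}\Rightarrow$; and $\stackrel{c!v\rhd\eta}{\Longrightarrow}$ is the least family of relations such that $\mathcal M\Rightarrow\xrightarrow{c!v\rhd\eta}\Rightarrow\Delta$ implies $\mathcal M\stackrel{c!v\rhd\eta}{\Longrightarrow}\Delta$, and $\mathcal M\stackrel{c!v\rhd\eta_1}{\Longrightarrow}\Delta'$, $\Delta'\stackrel{c!v\rhd\eta_2}{\Longrightarrow}\Delta$ (lifted), $\eta_1\cap\eta_2=\emptyset$ imply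 $\mathcal M\stackrel{c!v\rhd(\eta_1\cup\eta_2)}{\Longrightarrow}\Delta$. *Simulation.* $\lhd$ is the largest relation between well-formed networks such that $\mathcal M\lhd\mathcal N$ implies: $\mathrm{In}(\mathcal M)=\mathrm{In}(\mathcal N)$ and $\mathrm{Out}(\mathcal M)=\mathrm{Out}(\mathcal N)$; if $\mathcal M$ is successful, then $\mathcal N\stackrel{\tau}{\Longrightarrow}\Theta$ for some full distribution $\Theta$ all of whose support is successful; otherwise, for every extensional action $\lambda$ and every full distribution $\Delta$ with $\mathcal M\stackrel{\lambda}{\Longrightarrow}\Delta$ there is a full distribution $\Theta$ with $\mathcal N\stackrel{\lambda}{\Longrightarrow}\Theta$ and $\Delta\;\overline{\lhd^e}\;\Theta$. -/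

import Mathlib

open scoped ENNReal

noncomputable section

namespace WNet

universe u v

/-! ### Sub-distributions and probabilistic labelled transition systems

Full distributions are Mathlib's `PMF`. -/

section Prob

/-- A (probability) sub-distribution: a function to the non-negative reals of mass at most one. -/
@[ext]
structure SubDist (S : Type u) where
  toFun : S → ℝ≥0∞
  mass_le : ∑' s, toFun s ≤ 1

namespace SubDist

variable {S : Type u}

instance : CoeFun (SubDist S) (fun _ => S → ℝ≥0∞) := ⟨SubDist.toFun⟩

/-- A full distribution, seen as a sub-distribution. -/
def ofPMF (μ : PMF S) : SubDist S := ⟨fun s => μ s, μ.tsum_coe.le⟩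

/-- The point distribution at `s`. -/
def point (s : S) : SubDist S := ofPMF (PMF.pure s)

/-- The sub-distribution has mass one, that is, it is a (full) distribution. -/
def IsFull (Δ : SubDist S) : Prop := ∑' s, Δ s = 1

end SubDist

/-- The lifting of a relation from states to sub-distributions: the smallest relation between
sub-distributions which contains `point s ↦ Θ` for `R s Θ` and is closed under finite
sub-convex combinations. -/
inductive Lift {S : Type u} {T : Type v} (R : S → SubDist T → Prop) :
    SubDist S → SubDist T → Prop
  | base {s : S} {Θ : SubDist T} (h : R s Θ) : Lift R (SubDist.point s) Θ
  | comb {n : ℕ} (p : Fin n → ℝ≥0∞) (Δs : Fin n → SubDist S) (Θs : Fin n → SubDist T)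
      (Δ : SubDist S) (Θ : SubDist T) (hp : ∑ i, p i ≤ 1)
      (h : ∀ i, Lift R (Δs i) (Θs i))
      (hΔ : ∀ s, Δ s = ∑ i, p i * Δs i s) (hΘ : ∀ t, Θ t = ∑ i, p i * Θs i t) :
      Lift R Δ Θ

/-- A relation between states, seen as a relation from states to point distributions. -/
def toPoint {S : Type u} {T : Type v} (R : S → T → Prop) (s : S) (Θ : SubDist T) : Prop :=
  ∃ t, R s t ∧ Θ = SubDist.point t

/-- A probabilistic labelled transition system. -/
structure PLTS (S : Type u) (Act : Type v) where
  /-- the distinguished label of internal activity -/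
  tau : Act
  /-- the transition relation, from states to full distributions -/
  trans : S → Act → PMF S → Prop
  /-- the success predicate -/
  success : S → Prop

namespace PLTS

variable {S : Type u} {Act : Type v} (P : PLTS S Act)

/-- The transition relation of the pLTS, lifted to sub-distributions. -/
def Step (a : Act) : SubDist S → SubDist S → Prop :=
  Lift (fun s Θ => ∃ μ, P.trans s a μ ∧ Θ = SubDist.ofPMF μ)

/-- `P.Hyper Δ Δ'`: the sub-distribution `Δ'` is a hyper-derivative of `Δ`. The sub-distribution
`go k` is the part that moves on at stage `k` and `halt k` is the part that halts there. -/
def Hyper (Δ Δ' : SubDist S) : Prop :=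
  ∃ go halt : ℕ → SubDist S,
    (∀ s, Δ s = go 0 s + halt 0 s) ∧
    (∀ k, ∃ Θ, P.Step P.tau (go k) Θ ∧ ∀ s, Θ s = go (k + 1) s + halt (k + 1) s) ∧
    (∀ k s, go k s ≠ 0 → ¬ P.success s) ∧
    ∀ s, Δ' s = ∑' k, halt k s

/-- `P.Extreme Δ Δ'`: the sub-distribution `Δ'` is an extreme derivative of `Δ`. -/
def Extreme (Δ Δ' : SubDist S) : Prop :=
  P.Hyper Δ Δ' ∧ ∀ s, Δ' s ≠ 0 → (∃ μ, P.trans s P.tau μ) → P.success s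

open Classical in
/-- The value of a sub-distribution: the mass it gives to the successful states. -/
def value (Δ : SubDist S) : ℝ≥0∞ := ∑' s, if P.success s then Δ s else 0

/-- The set of possible results from a sub-distribution. -/
def Results (Δ : SubDist S) : Set ℝ≥0∞ := {q | ∃ Δ', P.Extreme Δ Δ' ∧ q = P.value Δ'}

/-- `P.Reachable s t`: the state `t` can be reached from `s` by transitions of the pLTS. -/
def Reachable : S → S → Prop :=
  Relation.ReflTransGen (fun s t => ∃ a μ, P.trans s a μ ∧ t ∈ μ.support)

end PLTS

/-- The Hoare preorder on sets of outcomes. -/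
def HoareLE (O₁ O₂ : Set ℝ≥0∞) : Prop := ∀ p₁ ∈ O₁, ∃ p₂ ∈ O₂, p₁ ≤ p₂

end Prob

/-! ### The calculus -/

/-- The names on which the calculus is built: node names, channel names, data values, and
identifiers of process definitions, each of the latter with its number of parameters. -/
structure Names where
  Node : Type u
  Chan : Type u
  Val : Type u
  Ident : Type u
  arity : Ident → ℕ

variable (L : Names.{u})

/-- Data expressions in `n` free variables, given by their meaning: a value for each valuation of
the variables. A closed expression is one with `n = 0`. -/
abbrev Expr (n : ℕ) : Type u := (Fin n → L.Val) → L.Val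

/-- Boolean expressions in `n` free variables. -/
abbrev BExpr (n : ℕ) : Type u := (Fin n → L.Val) → Bool

mutual

/-- (Probabilistic) process terms with at most `n` free variables. -/
inductive Proc : ℕ → Type u
  | state {n : ℕ} (s : State n) : Proc n
  /-- probabilistic choice, the left branch having probability `r` -/
  | choice {n : ℕ} (r : unitInterval) (p q : Proc n) : Proc n

/-- State terms with at most `n` free variables. Variables are de Bruijn indices: in
`rcv c p` the variable bound by the input is the variable `0` of `p`. -/
inductive State : ℕ → Type u
  /-- broadcast `c!⟨e⟩.p` -/
  | snd {n : ℕ} (c : L.Chan) (e : Expr L n) (p : Proc n) : State n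
  /-- receive `c?(x).p` -/
  | rcv {n : ℕ} (c : L.Chan) (p : Proc (n + 1)) : State n
  /-- the success test `ω.0` -/
  | test {n : ℕ} : State n
  | sum {n : ℕ} (s t : State n) : State n
  /-- `if b then s else t` -/
  | branch {n : ℕ} (b : BExpr L n) (s t : State n) : State n
  /-- preemption `τ.p` -/
  | pre {n : ℕ} (p : Proc n) : State n
  /-- definition call `A⟨e₁, …, eₖ⟩` -/
  | call {n : ℕ} (A : L.Ident) (e : Fin (L.arity A) → Expr L n) : State n
  | nil {n : ℕ} : State n

end

/-- The process definitions `A(x₁, …, xₖ) ⇐ s`. -/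
abbrev Definitions : Type u := (A : L.Ident) → State L (L.arity A)

variable {L}

/-- A simultaneous substitution for `m` variables by expressions in `n` variables. -/
abbrev Subst (L : Names.{u}) (m n : ℕ) : Type u := Fin m → Expr L n


/-- The substitution under a binder: it fixes the bound variable `0`. -/
def Subst.lift {m n : ℕ} (σ : Subst L m n) : Subst L (m + 1) (n + 1) :=
  Fin.cons (fun ρ => ρ 0) (fun i ρ => σ i (fun j => ρ j.succ))

mutual

def Proc.subst : {m : ℕ} → Proc L m → {n : ℕ} → Subst L m n → Proc L n
  | _, .state s, _, σ => .state (s.subst σ)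
  | _, .choice r p q, _, σ => .choice r (p.subst σ) (q.subst σ)

def State.subst : {m : ℕ} → State L m → {n : ℕ} → Subst L m n → State L n
  | _, .snd c e p, _, σ => .snd c (fun ρ => e (fun i => σ i ρ)) (p.subst σ)
  | _, .rcv c p, _, σ => .rcv c (p.subst σ.lift)
  | _, .test, _, _ => .test
  | _, .sum s t, _, σ => .sum (s.subst σ) (t.subst σ)
  | _, .branch b s t, _, σ => .branch (fun ρ => b (fun i => σ i ρ)) (s.subst σ) (t.subst σ)
  | _, .pre p, _, σ => .pre (p.subst σ)
  | _, .call A e, _, σ => .call A (fun j ρ => e j (fun i => σ i ρ))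
  | _, .nil, _, _ => .nil

end

/-- The evaluation of a closed (Boolean) expression. -/
def evalClosed {α : Type*} (e : (Fin 0 → L.Val) → α) : α := e Fin.elim0

/-- The mixture `r · μ + (1 - r) · ν`. -/
def mix {S : Type*} (r : unitInterval) (μ ν : PMF S) : PMF S :=
  ⟨fun s => ENNReal.ofReal r * μ s + ENNReal.ofReal (1 - r) * ν s, by
    have h : ∑' s, (ENNReal.ofReal r * μ s + ENNReal.ofReal (1 - r) * ν s) = 1 := by
      rw [ENNReal.tsum_add, ENNReal.tsum_mul_left, ENNReal.tsum_mul_left, μ.tsum_coe, ν.tsum_coe,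
        mul_one, mul_one, ← ENNReal.ofReal_add r.2.1 (by linarith [r.2.2])]
      simp
    exact h ▸ ENNReal.summable.hasSum⟩

/-- The distribution of states denoted by a process. -/
def Proc.interp : {n : ℕ} → Proc L n → PMF (State L n)
  | _, .state s => PMF.pure s
  | _, .choice r p q => mix r p.interp q.interp

/-- The actions of states: `c!v`, `c?v` and `τ`. -/
inductive SAct (L : Names.{u}) : Type u
  | snd (c : L.Chan) (v : L.Val)
  | rcv (c : L.Chan) (v : L.Val)
  | tau

/-- The pre-semantics of (closed) states, relative to process definitions `D`. -/
inductive SStep (D : Definitions L) : State L 0 → SAct L → PMF (State L 0) → Prop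
  | snd (c : L.Chan) (e : Expr L 0) (p : Proc L 0) :
      SStep D (.snd c e p) (.snd c (evalClosed e)) p.interp
  | rcv (c : L.Chan) (p : Proc L 1) (v : L.Val) :
      SStep D (.rcv c p) (.rcv c v) (p.subst (fun _ _ => v)).interp
  | tau (p : Proc L 0) : SStep D (.pre p) .tau p.interp
  | sumL {s t : State L 0} {a : SAct L} {Δ : PMF (State L 0)} :
      SStep D s a Δ → SStep D (.sum s t) a Δ
  | sumR {s t : State L 0} {a : SAct L} {Δ : PMF (State L 0)} :
      SStep D t a Δ → SStep D (.sum s t) a Δ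
  | thenB {b : BExpr L 0} {s t : State L 0} {a : SAct L} {Δ : PMF (State L 0)} :
      evalClosed b = true → SStep D s a Δ → SStep D (.branch b s t) a Δ
  | elseB {b : BExpr L 0} {s t : State L 0} {a : SAct L} {Δ : PMF (State L 0)} :
      evalClosed b = false → SStep D t a Δ → SStep D (.branch b s t) a Δ
  | call {A : L.Ident} {e : Fin (L.arity A) → Expr L 0} {a : SAct L} {Δ : PMF (State L 0)} :
      SStep D ((D A).subst e) a Δ → SStep D (.call A e) a Δ

/-- (Closed) system terms. -/
inductive Sys (L : Names.{u}) : Type u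
  /-- the node `n` running the code `s` -/
  | loc (s : State L 0) (n : L.Node)
  | par (M N : Sys L)
  | nil

/-- The list of the node names that occur in a system term. -/
def Sys.nodeList : Sys L → List L.Node
  | .loc _ n => [n]
  | .par M N => M.nodeList ++ N.nodeList
  | .nil => []

/-- The set of the node names that occur in a system term. -/
def Sys.nodes (M : Sys L) : Set L.Node := {n | n ∈ M.nodeList}

/-- Connectivity graphs: finite irreflexive directed graphs on node names. The edge relation
`E m n` says that `n` can detect the broadcasts of `m`. -/
@[ext]
structure Graph (L : Names.{u}) where
  V : Set L.Node
  finite_V : V.Finite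
  E : L.Node → L.Node → Prop
  left_mem : ∀ m n, E m n → m ∈ V
  right_mem : ∀ m n, E m n → n ∈ V
  irrefl : ∀ m, ¬ E m m

/-- The union of two connectivity graphs. -/
def Graph.union (Γ₁ Γ₂ : Graph L) : Graph L where
  V := Γ₁.V ∪ Γ₂.V
  finite_V := Γ₁.finite_V.union Γ₂.finite_V
  E m n := Γ₁.E m n ∨ Γ₂.E m n
  left_mem m n h := h.imp (Γ₁.left_mem m n) (Γ₂.left_mem m n)
  right_mem m n h := h.imp (Γ₁.right_mem m n) (Γ₂.right_mem m n)
  irrefl m h := h.elim (Γ₁.irrefl m) (Γ₂.irrefl m)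

/-- Intensional actions: `m.c!v`, `m.c?v` and `m.τ`. -/
inductive IAct (L : Names.{u}) : Type u
  | snd (m : L.Node) (c : L.Chan) (v : L.Val)
  | rcv (m : L.Node) (c : L.Chan) (v : L.Val)
  | tau (m : L.Node)

/-- The node `n` running code distributed according to `Δ`. -/
def locD (Δ : PMF (State L 0)) (n : L.Node) : PMF (Sys L) := Δ.map (fun s => .loc s n)

/-- Parallel composition of (independent) distributions of system terms. -/
def parD (Δ Θ : PMF (Sys L)) : PMF (Sys L) := Δ.bind fun M => Θ.map fun N => .par M N

/-- The intensional semantics of networks, relative to process definitions `D` and a connectivity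
graph `Γ`. -/
inductive IStep (D : Definitions L) (Γ : Graph L) : Sys L → IAct L → PMF (Sys L) → Prop
  | broad {s : State L 0} {c : L.Chan} {v : L.Val} {Δ : PMF (State L 0)} (n : L.Node) :
      SStep D s (.snd c v) Δ → IStep D Γ (.loc s n) (.snd n c v) (locD Δ n)
  | recv {s : State L 0} {c : L.Chan} {v : L.Val} {Δ : PMF (State L 0)} {m n : L.Node} :
      SStep D s (.rcv c v) Δ → Γ.E m n → IStep D Γ (.loc s n) (.rcv m c v) (locD Δ n)
  | deaf {s : State L 0} {c : L.Chan} {v : L.Val} (m n : L.Node) :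
      (∀ Δ, ¬ SStep D s (.rcv c v) Δ) →
      IStep D Γ (.loc s n) (.rcv m c v) (PMF.pure (.loc s n))
  | disc (s : State L 0) (c : L.Chan) (v : L.Val) {m n : L.Node} :
      ¬ Γ.E m n → IStep D Γ (.loc s n) (.rcv m c v) (PMF.pure (.loc s n))
  | nil (m : L.Node) (c : L.Chan) (v : L.Val) :
      IStep D Γ .nil (.rcv m c v) (PMF.pure .nil)
  | tau {s : State L 0} {Δ : PMF (State L 0)} (n : L.Node) :
      SStep D s .tau Δ → IStep D Γ (.loc s n) (.tau n) (locD Δ n)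
  | tauPropL {M : Sys L} {n : L.Node} {Δ : PMF (Sys L)} (N : Sys L) :
      IStep D Γ M (.tau n) Δ → IStep D Γ (.par M N) (.tau n) (parD Δ (PMF.pure N))
  | tauPropR {M : Sys L} {n : L.Node} {Δ : PMF (Sys L)} (N : Sys L) :
      IStep D Γ M (.tau n) Δ → IStep D Γ (.par N M) (.tau n) (parD (PMF.pure N) Δ)
  | prop {M N : Sys L} {m : L.Node} {c : L.Chan} {v : L.Val} {Δ Θ : PMF (Sys L)} :
      IStep D Γ M (.rcv m c v) Δ → IStep D Γ N (.rcv m c v) Θ →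
      IStep D Γ (.par M N) (.rcv m c v) (parD Δ Θ)
  | syncL {M N : Sys L} {m : L.Node} {c : L.Chan} {v : L.Val} {Δ Θ : PMF (Sys L)} :
      IStep D Γ M (.snd m c v) Δ → IStep D Γ N (.rcv m c v) Θ →
      IStep D Γ (.par M N) (.snd m c v) (parD Δ Θ)
  | syncR {M N : Sys L} {m : L.Node} {c : L.Chan} {v : L.Val} {Δ Θ : PMF (Sys L)} :
      IStep D Γ M (.rcv m c v) Δ → IStep D Γ N (.snd m c v) Θ →
      IStep D Γ (.par M N) (.snd m c v) (parD Δ Θ)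

/-! ### Structural congruence -/

/-- Structural congruence of (closed) states. -/
inductive SCong (D : Definitions L) : State L 0 → State L 0 → Prop
  | refl (s : State L 0) : SCong D s s
  | symm {s t : State L 0} : SCong D s t → SCong D t s
  | trans {s t r : State L 0} : SCong D s t → SCong D t r → SCong D s r
  | sum {s s' t t' : State L 0} :
      SCong D s s' → SCong D t t' → SCong D (.sum s t) (.sum s' t')
  | comm (s t : State L 0) : SCong D (.sum s t) (.sum t s)
  | assoc (s t r : State L 0) : SCong D (.sum (.sum s t) r) (.sum s (.sum t r))
  | unit (s : State L 0) : SCong D (.sum s .nil) s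
  | thenB {b : BExpr L 0} (s t : State L 0) :
      evalClosed b = true → SCong D (.branch b s t) s
  | elseB {b : BExpr L 0} (s t : State L 0) :
      evalClosed b = false → SCong D (.branch b s t) t
  | call (A : L.Ident) (e : Fin (L.arity A) → Expr L 0) :
      SCong D (.call A e) ((D A).subst e)

/-- Structural congruence of system terms. -/
inductive Cong (D : Definitions L) : Sys L → Sys L → Prop
  | refl (M : Sys L) : Cong D M M
  | symm {M N : Sys L} : Cong D M N → Cong D N M
  | trans {M N K : Sys L} : Cong D M N → Cong D N K → Cong D M K
  | par {M M' N N' : Sys L} : Cong D M M' → Cong D N N' → Cong D (.par M N) (.par M' N')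
  | comm (M N : Sys L) : Cong D (.par M N) (.par N M)
  | assoc (M N K : Sys L) : Cong D (.par (.par M N) K) (.par M (.par N K))
  | unit (M : Sys L) : Cong D (.par M .nil) M
  | loc {s t : State L 0} (n : L.Node) : SCong D s t → Cong D (.loc s n) (.loc t n)

/-- The success predicate on system terms: up to structural congruence, some node has the special
action `ω` enabled. -/
def Successful (D : Definitions L) (M : Sys L) : Prop :=
  ∃ (M' : Sys L) (s : State L 0) (n : L.Node), Cong D M (.par M' (.loc (.sum .test s) n))

/-! ### Networks -/

/-- A connectivity graph together with a system term. -/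
@[ext]
structure Net (L : Names.{u}) where
  graph : Graph L
  sys : Sys L

namespace Net

/-- The networks: each node name occurs at most once in the system term, and occupied nodes belong
to the connectivity graph. -/
def IsNetwork (M : Net L) : Prop := M.sys.nodeList.Nodup ∧ M.sys.nodes ⊆ M.graph.V

/-- Well-formed networks, the elements of the set `Nets`. -/
structure WellFormed (M : Net L) : Prop where
  isNetwork : M.IsNetwork
  /-- there is no connection between external nodes -/
  edge : ∀ m n, M.graph.E m n ∨ M.graph.E n m → m ∈ M.sys.nodes ∨ n ∈ M.sys.nodes
  /-- isolated nodes are internal -/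
  isolated : ∀ m ∈ M.graph.V, (¬ ∃ n ∈ M.graph.V, M.graph.E m n ∨ M.graph.E n m) →
    m ∈ M.sys.nodes

/-- The interface of a network: the set of its external nodes. -/
def interface (M : Net L) : Set L.Node := M.graph.V \ M.sys.nodes

/-- The input nodes of a network. -/
def inp (M : Net L) : Set L.Node := {i ∈ M.interface | ∃ m, M.graph.E i m}

/-- The output nodes of a network. -/
def outp (M : Net L) : Set L.Node := {o ∈ M.interface | ∃ m, M.graph.E m o}

/-- The composition of the network `M` with the (testing) network `P`; meaningful only when
`Composable M P` holds. -/
def comp (M P : Net L) : Net L := ⟨M.graph.union P.graph, .par M.sys P.sys⟩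

/-- The composition of `M` with `P` is defined. -/
def Composable (M P : Net L) : Prop := M.sys.nodes ∩ P.graph.V = ∅

/-- Structural congruence of networks. -/
def Congr (D : Definitions L) (M N : Net L) : Prop := M.graph = N.graph ∧ Cong D M.sys N.sys

/-- The success predicate on networks. -/
def Success (D : Definitions L) (M : Net L) : Prop := Successful D M.sys

end Net

/-- The distribution of networks with the fixed connectivity graph `Γ` and system terms distributed
according to `Δ`. -/
def netD (Γ : Graph L) (Δ : PMF (Sys L)) : PMF (Net L) := Δ.map (Net.mk Γ)

/-! ### Testing -/

/-- The reduction relation of networks. -/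
def Red (D : Definitions L) (M : Net L) (Λ : PMF (Net L)) : Prop :=
  ∃ Δ, Λ = netD M.graph Δ ∧
    ((∃ m, IStep D M.graph M.sys (.tau m) Δ) ∨ ∃ m c v, IStep D M.graph M.sys (.snd m c v) Δ)

/-- The testing structure of networks, as a pLTS whose only action is internal activity. -/
def testing (D : Definitions L) : PLTS (Net L) Unit where
  tau := ()
  trans M _ Λ := Red D M Λ
  success := Net.Success D

/-- The set of possible results of a network, run in isolation. -/
def netResults (D : Definitions L) (M : Net L) : Set ℝ≥0∞ :=
  (testing D).Results (SubDist.point M)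

/-- The may-testing preorder (on well-formed networks). -/
def MayLE (D : Definitions L) (M₁ M₂ : Net L) : Prop :=
  M₁.inp = M₂.inp ∧ M₁.outp = M₂.outp ∧
    ∀ T : Net L, T.WellFormed → M₁.Composable T → M₂.Composable T →
      HoareLE (netResults D (M₁.comp T)) (netResults D (M₂.comp T))

/-! ### Extensional semantics -/

/-- Extensional actions: internal activity, input `n.c?v`, and output `c!v ▷ η` to the target
set `η`. -/
inductive EAct (L : Names.{u}) : Type u
  | tau
  | inp (n : L.Node) (c : L.Chan) (v : L.Val)
  | out (c : L.Chan) (v : L.Val) (η : Set L.Node)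

/-- Strong extensional actions. -/
inductive EStep (D : Definitions L) : Net L → EAct L → PMF (Net L) → Prop
  | tau {M : Net L} {m : L.Node} {Δ : PMF (Sys L)} :
      ¬ M.Success D → IStep D M.graph M.sys (.tau m) Δ →
      EStep D M .tau (netD M.graph Δ)
  | tauBroad {M : Net L} {n : L.Node} {c : L.Chan} {v : L.Val} {Δ : PMF (Sys L)} :
      ¬ M.Success D → IStep D M.graph M.sys (.snd n c v) Δ →
      (∀ m, M.graph.E n m → m ∈ M.sys.nodes) →
      EStep D M .tau (netD M.graph Δ)
  | inp {M : Net L} {n : L.Node} {c : L.Chan} {v : L.Val} {Δ : PMF (Sys L)} :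
      ¬ M.Success D → IStep D M.graph M.sys (.rcv n c v) Δ → n ∈ M.inp →
      EStep D M (.inp n c v) (netD M.graph Δ)
  | out {M : Net L} {m : L.Node} {c : L.Chan} {v : L.Val} {Δ : PMF (Sys L)} {η : Set L.Node} :
      ¬ M.Success D → IStep D M.graph M.sys (.snd m c v) Δ →
      η = {o ∈ M.outp | M.graph.E m o} → η.Nonempty →
      EStep D M (.out c v η) (netD M.graph Δ)

/-- The pLTS of networks given by the strong extensional actions. -/
def extensional (D : Definitions L) : PLTS (Net L) (EAct L) where
  tau := .tau
  trans := EStep D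
  success := Net.Success D

/-- A network is finitary: the networks reachable from it by extensional actions are finitely many,
and each of them has finitely many outgoing transitions. Networks, and distributions of networks,
are counted up to structural congruence. -/
def Finitary (D : Definitions L) (M : Net L) : Prop :=
  (∃ F : Set (Net L), F.Finite ∧
    ∀ K, (extensional D).Reachable M K → ∃ K' ∈ F, K.Congr D K') ∧
  ∀ K, (extensional D).Reachable M K →
    ∃ F : Set (PMF (Net L)), F.Finite ∧
      ∀ a Δ, EStep D K a Δ →
        ∃ Θ ∈ F, Lift (toPoint (Net.Congr D)) (SubDist.ofPMF Δ) (SubDist.ofPMF Θ)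

/-- The closure conditions that define the weak outputs of `c!v`: a weak output to `η` is an output
to `η` preceded and followed by internal activity, or a weak output to `η₁` followed by a weak
output to `η₂`, where `η` is the disjoint union of `η₁` and `η₂`. -/
structure WeakOutClosed (D : Definitions L) (c : L.Chan) (v : L.Val)
    (X : Set L.Node → Net L → SubDist (Net L) → Prop) : Prop where
  single : ∀ {η M Δ₁ Δ₂ Δ}, (extensional D).Hyper (SubDist.point M) Δ₁ →
    (extensional D).Step (.out c v η) Δ₁ Δ₂ → (extensional D).Hyper Δ₂ Δ → X η M Δ
  multi : ∀ {η₁ η₂ M Δ' Δ}, X η₁ M Δ' → Lift (X η₂) Δ' Δ → η₁ ∩ η₂ = ∅ → X (η₁ ∪ η₂) M Δ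

/-- Weak extensional outputs: the least relation that satisfies the closure conditions. -/
def WeakOut (D : Definitions L) (c : L.Chan) (v : L.Val) (η : Set L.Node) (M : Net L)
    (Δ : SubDist (Net L)) : Prop :=
  ∀ X, WeakOutClosed D c v X → X η M Δ

theorem Lift.mono {S : Type u} {T : Type v} {R R' : S → SubDist T → Prop}
    (hR : ∀ s Θ, R s Θ → R' s Θ) {Δ : SubDist S} {Θ : SubDist T} (h : Lift R Δ Θ) :
    Lift R' Δ Θ := by
  induction h with
  | base h => exact .base (hR _ _ h)
  | comb p Δs Θs Δ Θ hp _ hΔ hΘ ih => exact .comb p Δs Θs Δ Θ hp ih hΔ hΘ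

/-- The weak outputs themselves satisfy the closure conditions. -/
theorem weakOutClosed_weakOut (D : Definitions L) (c : L.Chan) (v : L.Val) :
    WeakOutClosed D c v (WeakOut D c v) where
  single h₁ h₂ h₃ _ hX := hX.single h₁ h₂ h₃
  multi h₁ h₂ hη X hX := hX.multi (h₁ X hX) (h₂.mono fun _ _ h => h X hX) hη

/-- Weak extensional actions. -/
def Weak (D : Definitions L) : EAct L → Net L → SubDist (Net L) → Prop
  | .tau, M, Δ => (extensional D).Hyper (SubDist.point M) Δ
  | .inp n c v, M, Δ => ∃ Δ₁ Δ₂, (extensional D).Hyper (SubDist.point M) Δ₁ ∧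
      (extensional D).Step (.inp n c v) Δ₁ Δ₂ ∧ (extensional D).Hyper Δ₂ Δ
  | .out c v η, M, Δ => WeakOut D c v η M Δ

/-- A relation on well-formed networks satisfies the simulation conditions. As the transitions of a
pLTS lead to full distributions, only the weak actions that lead to distributions of mass one
count. -/
structure IsSimulation (D : Definitions L) (R : Net L → Net L → Prop) : Prop where
  wellFormed : ∀ {M N}, R M N → M.WellFormed ∧ N.WellFormed
  inp : ∀ {M N}, R M N → M.inp = N.inp
  outp : ∀ {M N}, R M N → M.outp = N.outp
  success : ∀ {M N}, R M N → M.Success D →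
    ∃ Θ, Θ.IsFull ∧ Weak D .tau N Θ ∧ ∀ K, Θ K ≠ 0 → K.Success D
  step : ∀ {M N}, R M N → ¬ M.Success D → ∀ (a : EAct L) (Δ : SubDist (Net L)), Δ.IsFull →
    Weak D a M Δ → ∃ Θ, Θ.IsFull ∧ Weak D a N Θ ∧ Lift (toPoint R) Δ Θ

/-- The simulation preorder: the largest relation that satisfies the simulation conditions. -/
def Sim (D : Definitions L) (M N : Net L) : Prop := ∃ R, IsSimulation D R ∧ R M N

end WNet

end

-- Fix a test `T` and relate `M.comp T` to `N.comp T` whenever `Sim D M N` (`SimComp`). A reduction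
-- of `M.comp T` is either an extensional action of `M` together with a reaction of the test, or a
-- move of the test that leaves `M` unchanged. In the first case simulation supplies a weak action
-- of `N`, which is replayed in the context; in the second the test makes the same move next to `N`.
-- One broadcast on the left may be answered by several on the right with disjoint target sets; a
-- node of the test lies in at most one of them, so its reaction can be distributed over them
-- (`React.split`). During such an answer the test may already be successful while `N` still moves.
-- The answers are therefore recorded by `Evolves`, which lets successful states move
-- (`matching_simComp`).
--
-- What remains concerns probabilistic systems only. Let `opt` be the supremum of the probabilities
-- of reaching success. It does not increase on average along any transition, hence along `Evolves`.
-- So the infimum of `opt` over the partners of a left state dominates the success indicator and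
-- does not increase on average along moves of unsuccessful left states. Consequently a result from
-- `x` is at most `opt s` for each partner `s` (`Matching.expect_ind_le`). A result strictly below
-- `opt s` is reached by a finite-horizon policy from `s` (`le_progressProb`).
--
-- The delicate case is equality, because a supremum over infinitely many choices need not be
-- attained. Equality leaves no slack anywhere: all moves on the left, and their answers on the
-- right, preserve the values in question. This yields a set `J` of right states on which the full
-- optimum can be approximated by transitions that preserve it and stay in `J`
-- (`Matching.exists_conserving`). Among such transitions a policy may aim for half of the optimum,
-- then for half of the optimum of wherever it has come to, and so on. Nothing is lost between
-- rounds and the deficit halves in each, so the policy attains the optimum (`opt_le_progressProb`).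
-- Policies with memory are turned into extreme derivations by `exists_extreme_of_policy`, and
-- `Matching.hoareLE` combines the two cases.

noncomputable section

namespace WNet

universe u v

/-! ### Weighted sums of non-negative functions -/

section Expectation

variable {S : Type u} {T : Type v}

/-- The expectation of `h` under the weights `m`. -/
def expect (m h : S → ℝ≥0∞) : ℝ≥0∞ := ∑' s, m s * h s

theorem expect_pure (s : S) (h : S → ℝ≥0∞) : expect (PMF.pure s) h = h s := by
  unfold expect
  rw [tsum_eq_single s]
  · simp
  · intro t ht
    simp [PMF.pure_apply, ht]

theorem expect_combination {ι : Type*} {m h : S → ℝ≥0∞} {p : ι → ℝ≥0∞} {M : ι → S → ℝ≥0∞}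
    (hm : ∀ s, m s = ∑' i, p i * M i s) : expect m h = ∑' i, p i * expect (M i) h := by
  unfold expect
  simp_rw [hm, ← ENNReal.tsum_mul_left, ← ENNReal.tsum_mul_right]
  rw [ENNReal.tsum_comm]
  simp_rw [mul_assoc]

theorem expect_add (m m' h : S → ℝ≥0∞) :
    expect (fun s => m s + m' s) h = expect m h + expect m' h := by
  unfold expect
  simp_rw [add_mul]
  exact ENNReal.tsum_add

theorem expect_tsum {ι : Type*} (M : ι → S → ℝ≥0∞) (h : S → ℝ≥0∞) :
    expect (fun s => ∑' i, M i s) h = ∑' i, expect (M i) h := by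
  have := expect_combination (m := fun s => ∑' i, M i s) (h := h) (p := fun _ : ι => 1) (M := M)
    (by simp)
  simpa using this

theorem expect_bind (μ : PMF S) (κ : S → PMF T) (h : T → ℝ≥0∞) :
    expect (μ.bind κ) h = expect μ fun s => expect (κ s) h :=
  expect_combination fun t => PMF.bind_apply μ κ t

theorem expect_map (μ : PMF S) (f : S → T) (h : T → ℝ≥0∞) :
    expect (μ.map f) h = expect μ fun s => h (f s) := by
  rw [PMF.map, expect_bind]
  simp [expect_pure]

theorem expect_mono {m h g : S → ℝ≥0∞} (H : ∀ s, m s ≠ 0 → h s ≤ g s) :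
    expect m h ≤ expect m g := by
  refine ENNReal.tsum_le_tsum fun s => ?_
  by_cases hs : m s = 0
  · simp [hs]
  · exact mul_le_mul_right (H s hs) _

theorem expect_const (m : S → ℝ≥0∞) (c : ℝ≥0∞) : expect m (fun _ => c) = (∑' s, m s) * c :=
  ENNReal.tsum_mul_right

theorem expect_pmf_const (μ : PMF S) (c : ℝ≥0∞) : expect μ (fun _ => c) = c := by
  rw [expect_const, μ.tsum_coe, one_mul]

theorem expect_pmf_le {μ : PMF S} {h : S → ℝ≥0∞} {c : ℝ≥0∞} (H : ∀ s, h s ≤ c) :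
    expect μ h ≤ c :=
  (expect_mono fun s _ => H s).trans (expect_pmf_const μ c).le

theorem expect_mul_right (m h : S → ℝ≥0∞) (c : ℝ≥0∞) :
    expect m (fun s => c * h s) = c * expect m h := by
  unfold expect
  rw [← ENNReal.tsum_mul_left]
  exact tsum_congr fun s => mul_left_comm _ _ _

theorem expect_add_right (m h g : S → ℝ≥0∞) :
    expect m (fun s => h s + g s) = expect m h + expect m g := by
  unfold expect
  simp_rw [mul_add]
  exact ENNReal.tsum_add

theorem expect_combination_right {ι : Type*} (m : S → ℝ≥0∞) (p : ι → ℝ≥0∞)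
    (h : ι → S → ℝ≥0∞) :
    expect m (fun s => ∑' i, p i * h i s) = ∑' i, p i * expect m (h i) := by
  unfold expect
  simp_rw [← ENNReal.tsum_mul_left]
  rw [ENNReal.tsum_comm]
  simp_rw [mul_left_comm]

theorem expect_iSup {m : S → ℝ≥0∞} {h : ℕ → S → ℝ≥0∞} (H : ∀ s, Monotone fun n => h n s) :
    expect m (fun s => ⨆ n, h n s) = ⨆ n, expect m (h n) := by
  unfold expect
  simp_rw [ENNReal.tsum_eq_iSup_sum, ENNReal.mul_iSup]
  rw [iSup_comm]
  congr 1
  funext F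
  exact ENNReal.finsetSum_iSup_of_monotone fun s i j hij => mul_le_mul_right (H s hij) _

/-- If a weighted sum of larger terms does not exceed that of smaller terms, then the terms of
positive weight agree. -/
theorem le_of_weighted_tsum_le {ι : Type*} {p a b : ι → ℝ≥0∞} (hle : ∀ i, p i ≠ 0 → b i ≤ a i)
    (hsum : ∑' i, p i * a i ≤ ∑' i, p i * b i) (hfin : ∑' i, p i * a i ≠ ⊤) {i : ι}
    (hi : p i ≠ 0) : a i ≤ b i := by
  by_contra hlt
  rw [not_le] at hlt
  have hai : p i * a i ≠ ⊤ := ENNReal.ne_top_of_tsum_ne_top hfin i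
  have hle' : ∀ j, p j * b j ≤ p j * a j := fun j => by
    by_cases hj : p j = 0
    · simp [hj]
    · exact mul_le_mul_right (hle j hj) _
  have hpi : p i ≠ ⊤ := fun h => hai (by
    rw [h, ENNReal.top_mul (ne_bot_of_gt hlt)])
  refine absurd hsum (not_le.mpr ?_)
  refine ENNReal.tsum_lt_tsum (i := i) (ne_top_of_le_ne_top hfin (ENNReal.tsum_le_tsum hle')) hle' ?_
  exact (ENNReal.mul_lt_mul_iff_right hi hpi).mpr hlt

theorem le_of_expect_le {m h g : S → ℝ≥0∞} (hle : ∀ s, m s ≠ 0 → g s ≤ h s)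
    (hsum : expect m h ≤ expect m g) (hfin : expect m h ≠ ⊤) {s : S} (hs : m s ≠ 0) :
    h s ≤ g s :=
  le_of_weighted_tsum_le hle hsum hfin hs

end Expectation

-- Telescoping inequalities

theorem tsum_shift_le {A B : ℕ → ℝ≥0∞} (h : ∀ k, B k + A (k + 1) ≤ A k) (k : ℕ) :
    ∑' j, B (k + j) ≤ A k := by
  rw [ENNReal.tsum_eq_iSup_nat]
  refine iSup_le fun n => ?_
  suffices ∑ j ∈ Finset.range n, B (k + j) + A (k + n) ≤ A k from le_self_add.trans this
  induction n with
  | zero => simp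
  | succ n ih =>
    rw [Finset.sum_range_succ, add_assoc]
    exact (add_le_add_right (h (k + n)) _).trans ih

/-- Read `A k` as the potential left at time `k` and `B k` as the amount paid out then. If the
payments exhaust the initial potential, then the payments before `k`, which are finite, can be
cancelled, and those from `k` on must cover `A k`. -/
theorem le_tsum_shift {A B : ℕ → ℝ≥0∞} (h : ∀ k, B k + A (k + 1) ≤ A k)
    (h0 : A 0 ≤ ∑' j, B j) (hfin : A 0 ≠ ⊤) (k : ℕ) : A k ≤ ∑' j, B (k + j) := by
  have key : ∀ n, ∑ j ∈ Finset.range n, B j + A n ≤ A 0 := by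
    intro n
    induction n with
    | zero => simp
    | succ n ih =>
      rw [Finset.sum_range_succ, add_assoc]
      exact (add_le_add_right (h n) _).trans ih
  have hs : ∑ j ∈ Finset.range k, B j ≠ ⊤ :=
    ne_top_of_le_ne_top hfin (le_self_add.trans (key k))
  have := (key k).trans h0
  rw [← ENNReal.summable.sum_add_tsum_nat_add' (k := k), ENNReal.add_le_add_iff_left hs] at this
  simpa [add_comm] using this

theorem antitone_of_shift_le {A B : ℕ → ℝ≥0∞} (h : ∀ k, B k + A (k + 1) ≤ A k) (k : ℕ) :
    A k ≤ A 0 := by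
  induction k with
  | zero => exact le_rfl
  | succ k ih => exact (le_add_self.trans (h k)).trans ih

theorem le_shift_of_tight {A B : ℕ → ℝ≥0∞} (h : ∀ k, B k + A (k + 1) ≤ A k)
    (h0 : A 0 ≤ ∑' j, B j) (hfin : A 0 ≠ ⊤) (k : ℕ) : A k ≤ B k + A (k + 1) := by
  refine (le_tsum_shift h h0 hfin k).trans ?_
  rw [tsum_eq_zero_add' ENNReal.summable]
  refine add_le_add_right ?_ _
  have := tsum_shift_le h (k + 1)
  simpa [add_assoc, add_comm 1] using this

/-! ### Reachability values -/

section Opt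

variable {S : Type u} (A : S → PMF S → Prop) (succ : S → Prop)

open Classical in
/-- The indicator function of the successful states. -/
def ind (s : S) : ℝ≥0∞ := if succ s then 1 else 0

open Classical in
/-- The optimal probability of reaching success within `n` transitions chosen from `A`. -/
def optN : ℕ → S → ℝ≥0∞
  | 0, s => ind succ s
  | n + 1, s => if succ s then 1 else ⨆ μ, ⨆ _ : A s μ, expect μ (optN n)

/-- The optimal probability of reaching success by transitions chosen from `A`. -/
def opt (s : S) : ℝ≥0∞ := ⨆ n, optN A succ n s

variable {A succ}

theorem ind_of {s : S} (h : succ s) : ind succ s = 1 := by simp [ind, h]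

theorem ind_of_not {s : S} (h : ¬ succ s) : ind succ s = 0 := by simp [ind, h]

theorem ind_le_one (s : S) : ind succ s ≤ 1 := by
  unfold ind; split <;> simp

theorem optN_of {s : S} (h : succ s) (n : ℕ) : optN A succ n s = 1 := by
  cases n <;> simp [optN, h, ind]

theorem optN_succ_of_not {s : S} (h : ¬ succ s) (n : ℕ) :
    optN A succ (n + 1) s = ⨆ μ, ⨆ _ : A s μ, expect μ (optN A succ n) := by
  simp [optN, h]

theorem optN_le_one (n : ℕ) (s : S) : optN A succ n s ≤ 1 := by
  induction n generalizing s with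
  | zero => exact ind_le_one s
  | succ n ih =>
    by_cases h : succ s
    · rw [optN_of h]
    · rw [optN_succ_of_not h]
      exact iSup₂_le fun μ _ => expect_pmf_le ih

theorem optN_le_succ (n : ℕ) (s : S) : optN A succ n s ≤ optN A succ (n + 1) s := by
  by_cases h : succ s
  · rw [optN_of h, optN_of h]
  induction n generalizing s with
  | zero => simp [optN, ind_of_not h]
  | succ n ih =>
    rw [optN_succ_of_not h, optN_succ_of_not h]
    refine iSup₂_mono fun μ _ => expect_mono fun t _ => ?_
    by_cases ht : succ t
    · rw [optN_of ht, optN_of ht]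
    · exact ih t ht

theorem optN_monotone (s : S) : Monotone fun n => optN A succ n s :=
  monotone_nat_of_le_succ fun n => optN_le_succ n s

theorem optN_mono_left {A' : S → PMF S → Prop} (hA : ∀ s μ, A s μ → A' s μ) (n : ℕ) (s : S) :
    optN A succ n s ≤ optN A' succ n s := by
  induction n generalizing s with
  | zero => exact le_rfl
  | succ n ih =>
    by_cases h : succ s
    · rw [optN_of h, optN_of h]
    · rw [optN_succ_of_not h, optN_succ_of_not h]
      exact iSup₂_le fun μ hμ => le_iSup₂_of_le μ (hA s μ hμ) (expect_mono fun t _ => ih t)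

theorem opt_mono_left {A' : S → PMF S → Prop} (hA : ∀ s μ, A s μ → A' s μ) (s : S) :
    opt A succ s ≤ opt A' succ s :=
  iSup_mono fun n => optN_mono_left hA n s

theorem opt_le_one (s : S) : opt A succ s ≤ 1 := iSup_le fun n => optN_le_one n s

theorem opt_ne_top (s : S) : opt A succ s ≠ ⊤ :=
  ne_top_of_le_ne_top ENNReal.one_ne_top (opt_le_one s)

theorem opt_of {s : S} (h : succ s) : opt A succ s = 1 :=
  le_antisymm (opt_le_one s) (le_iSup_of_le 0 (optN_of h 0).ge)

/-- The optimum is superharmonic. By monotone convergence the expectation of the supremum is the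
supremum over `n` of the expectations of `optN n`, and each of these competes in `optN (n + 1)` at
the source. At a successful source, where transitions may exist as well, the bound by one suffices.
-/
theorem expect_opt_le {s : S} {μ : PMF S} (h : A s μ) : expect μ (opt A succ) ≤ opt A succ s := by
  by_cases hs : succ s
  · rw [opt_of hs]
    exact expect_pmf_le opt_le_one
  · unfold opt
    rw [expect_iSup optN_monotone]
    refine iSup_le fun n => le_iSup_of_le (n + 1) ?_
    rw [optN_succ_of_not hs]
    exact le_iSup₂_of_le μ h le_rfl

end Opt

/-! ### Unrestricted derivations -/

section Derivations

variable {S : Type u}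

/-- A decomposition of a weighted family of transitions from `m` to `m'`. -/
structure Flow (A : S → PMF S → Prop) (m m' : S → ℝ≥0∞) where
  ι : Type u
  weight : ι → ℝ≥0∞
  src : ι → S
  tgt : ι → PMF S
  trans : ∀ i, weight i ≠ 0 → A (src i) (tgt i)
  left : ∀ s, m s = ∑' i, weight i * PMF.pure (src i) s
  right : ∀ s, m' s = ∑' i, weight i * tgt i s

namespace Flow

variable {A : S → PMF S → Prop} {m m' : S → ℝ≥0∞} (F : Flow A m m')

include F in
theorem expect_left (h : S → ℝ≥0∞) : expect m h = ∑' i, F.weight i * h (F.src i) := by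
  rw [expect_combination F.left]
  simp_rw [expect_pure]

include F in
theorem expect_right (h : S → ℝ≥0∞) : expect m' h = ∑' i, F.weight i * expect (F.tgt i) h :=
  expect_combination F.right

theorem src_ne_zero {i : F.ι} (hi : F.weight i ≠ 0) : m (F.src i) ≠ 0 := by
  rw [F.left]
  refine fun h => hi ?_
  simpa using ENNReal.tsum_eq_zero.mp h i

theorem tgt_ne_zero {i : F.ι} (hi : F.weight i ≠ 0) {t : S} (ht : F.tgt i t ≠ 0) : m' t ≠ 0 := by
  rw [F.right]
  exact fun h => mul_ne_zero hi ht (ENNReal.tsum_eq_zero.mp h i)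

theorem exists_of_ne_zero {t : S} (ht : m' t ≠ 0) : ∃ i, F.weight i ≠ 0 ∧ F.tgt i t ≠ 0 := by
  rw [F.right] at ht
  by_contra! H
  refine ht (ENNReal.tsum_eq_zero.mpr fun i => ?_)
  by_cases hi : F.weight i = 0
  · simp [hi]
  · simp [H i hi]

theorem expect_le {h : S → ℝ≥0∞}
    (H : ∀ i, F.weight i ≠ 0 → expect (F.tgt i) h ≤ h (F.src i)) : expect m' h ≤ expect m h := by
  rw [F.expect_left, F.expect_right]
  refine ENNReal.tsum_le_tsum fun i => ?_
  by_cases hi : F.weight i = 0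
  · simp [hi]
  · exact mul_le_mul_right (H i hi) _

theorem le_expect_tgt {h : S → ℝ≥0∞}
    (H : ∀ i, F.weight i ≠ 0 → expect (F.tgt i) h ≤ h (F.src i))
    (hle : expect m h ≤ expect m' h) (hfin : expect m h ≠ ⊤) {i : F.ι} (hi : F.weight i ≠ 0) :
    h (F.src i) ≤ expect (F.tgt i) h := by
  rw [F.expect_left, F.expect_right] at *
  exact le_of_weighted_tsum_le (a := fun i => h (F.src i)) (b := fun i => expect (F.tgt i) h) H hle
    hfin hi

/-- A single transition. -/
def single {s : S} {μ : PMF S} (h : A s μ) : Flow A (PMF.pure s) μ where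
  ι := PUnit
  weight _ := 1
  src _ := s
  tgt _ := μ
  trans _ _ := h
  left _ := by simp
  right _ := by simp

/-- A weighted combination of flows. -/
def comb {κ : Type u} (c : κ → ℝ≥0∞) {M M' : κ → S → ℝ≥0∞} (G : ∀ i, Flow A (M i) (M' i))
    (hm : ∀ s, m s = ∑' i, c i * M i s) (hm' : ∀ s, m' s = ∑' i, c i * M' i s) :
    Flow A m m' where
  ι := Σ i, (G i).ι
  weight x := c x.1 * (G x.1).weight x.2
  src x := (G x.1).src x.2
  tgt x := (G x.1).tgt x.2
  trans x hx := (G x.1).trans x.2 (right_ne_zero_of_mul hx)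
  left s := by
    rw [hm, ENNReal.tsum_sigma']
    simp_rw [(G _).left, ← ENNReal.tsum_mul_left, mul_assoc]
  right s := by
    rw [hm', ENNReal.tsum_sigma']
    simp_rw [(G _).right, ← ENNReal.tsum_mul_left, mul_assoc]

/-- The empty flow. -/
def zero : Flow A (fun _ => 0) (fun _ => 0) where
  ι := PEmpty
  weight _ := 0
  src i := i.elim
  tgt i := i.elim
  trans i := i.elim
  left _ := by simp
  right _ := by simp

end Flow

/-- A derivation in infinitely many stages: the part `go k` moves on at stage `k`, and the part
`halt k` halts there. Successful states may move. -/
structure Deriv (A : S → PMF S → Prop) (m m' : S → ℝ≥0∞) where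
  go : ℕ → S → ℝ≥0∞
  halt : ℕ → S → ℝ≥0∞
  init : ∀ s, m s = go 0 s + halt 0 s
  flow : ∀ k, Flow A (go k) (fun s => go (k + 1) s + halt (k + 1) s)
  result : ∀ s, m' s = ∑' k, halt k s

namespace Deriv

variable {A : S → PMF S → Prop} {m m' : S → ℝ≥0∞} (d : Deriv A m m')

/-- The mass that is present at stage `k`. -/
def stage (k : ℕ) (s : S) : ℝ≥0∞ := d.go k s + d.halt k s

theorem stage_zero : d.stage 0 = m := funext fun s => (d.init s).symm

theorem expect_stage (k : ℕ) (h : S → ℝ≥0∞) :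
    expect (d.stage k) h = expect (d.go k) h + expect (d.halt k) h :=
  expect_add _ _ _

include d in
theorem expect_result (h : S → ℝ≥0∞) : expect m' h = ∑' k, expect (d.halt k) h := by
  rw [← expect_tsum]
  congr
  funext s
  exact d.result s

theorem result_ne_zero {k : ℕ} {s : S} (h : d.halt k s ≠ 0) : m' s ≠ 0 := by
  rw [d.result]
  exact fun h' => h (ENNReal.tsum_eq_zero.mp h' k)

theorem stage_ne_zero_of_go {k : ℕ} {s : S} (h : d.go k s ≠ 0) : d.stage k s ≠ 0 :=
  fun h' => h (add_eq_zero.mp h').1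

theorem stage_ne_zero_of_halt {k : ℕ} {s : S} (h : d.halt k s ≠ 0) : d.stage k s ≠ 0 :=
  fun h' => h (add_eq_zero.mp h').2

/-- The expectation of `h` does not increase along the moves of the derivation. -/
def Super (h : S → ℝ≥0∞) : Prop :=
  ∀ k i, (d.flow k).weight i ≠ 0 → expect ((d.flow k).tgt i) h ≤ h ((d.flow k).src i)

/-- The inequality that feeds the telescoping lemmas: the potential is the expectation of `h` over a
stage, and the payment is the expectation of `g` over the mass that halts there. -/
theorem halt_add_stage_le {g h : S → ℝ≥0∞} (H : d.Super h)
    (hg : ∀ k s, d.halt k s ≠ 0 → g s ≤ h s) (k : ℕ) :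
    expect (d.halt k) g + expect (d.stage (k + 1)) h ≤ expect (d.stage k) h := by
  rw [d.expect_stage k, add_comm]
  exact add_le_add ((d.flow k).expect_le (H k)) (expect_mono (hg k))

/-- If the total payment equals the initial potential, no single stage can lose any. The halting
contribution is finite, so it cancels and leaves the inequality for the moving part alone. -/
theorem go_le_stage_of_tight {g h : S → ℝ≥0∞} (H : d.Super h)
    (hg : ∀ k s, d.halt k s ≠ 0 → g s ≤ h s) (htight : expect m h ≤ expect m' g)
    (hfin : expect m h ≠ ⊤) (k : ℕ) :
    expect (d.go k) h ≤ expect (d.stage (k + 1)) h ∧ expect (d.stage k) h ≠ ⊤ := by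
  rw [← d.stage_zero, d.expect_result] at htight
  rw [← d.stage_zero] at hfin
  have hk : expect (d.stage k) h ≠ ⊤ :=
    ne_top_of_le_ne_top hfin (antitone_of_shift_le (A := fun k => expect (d.stage k) h)
      (B := fun k => expect (d.halt k) g) (d.halt_add_stage_le H hg) k)
  refine ⟨?_, hk⟩
  have h1 := le_shift_of_tight (A := fun k => expect (d.stage k) h)
    (B := fun k => expect (d.halt k) g) (d.halt_add_stage_le H hg) htight hfin k
  have h2 : expect (d.halt k) g ≤ expect (d.halt k) h := expect_mono (hg k)
  have h3 : expect (d.halt k) h ≠ ⊤ :=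
    ne_top_of_le_ne_top hk (by rw [expect_stage]; exact le_add_self)
  have h4 : expect (d.go k) h + expect (d.halt k) h
      ≤ expect (d.stage (k + 1)) h + expect (d.halt k) h := by
    rw [← expect_stage]
    refine h1.trans ?_
    rw [add_comm]
    exact add_le_add_right h2 _
  exact (ENNReal.add_le_add_iff_right h3).mp h4

theorem le_expect_tgt_of_tight {g h : S → ℝ≥0∞} (H : d.Super h)
    (hg : ∀ k s, d.halt k s ≠ 0 → g s ≤ h s) (htight : expect m h ≤ expect m' g)
    (hfin : expect m h ≠ ⊤) {k : ℕ} {i : (d.flow k).ι} (hi : (d.flow k).weight i ≠ 0) :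
    h ((d.flow k).src i) ≤ expect ((d.flow k).tgt i) h := by
  obtain ⟨h1, h2⟩ := d.go_le_stage_of_tight H hg htight hfin k
  refine (d.flow k).le_expect_tgt (H k) h1 (ne_top_of_le_ne_top h2 ?_) hi
  rw [expect_stage]
  exact le_self_add

/-- Two functions that do not increase along a derivation, the first of which is tight with respect
to the outcome `g`: if the second does not exceed the first, then they agree at every state that is
visited. -/
theorem le_of_tight {g h f : S → ℝ≥0∞} (H : d.Super h) (Hf : d.Super f)
    (hg : ∀ k s, d.halt k s ≠ 0 → g s ≤ h s) (hgf : ∀ k s, d.halt k s ≠ 0 → g s ≤ f s)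
    (htight : expect m h ≤ expect m' g) (hfin : expect m h ≠ ⊤)
    (hfh : ∀ k s, d.stage k s ≠ 0 → f s ≤ h s) {k : ℕ} {s : S} (hs : d.stage k s ≠ 0) :
    h s ≤ f s := by
  have hk := (d.go_le_stage_of_tight H hg htight hfin k).2
  rw [← d.stage_zero, d.expect_result] at htight
  rw [← d.stage_zero] at hfin
  -- At stage `k` the remaining payments are at least the potential `h`, by tightness, and at most
  -- the potential `f`. Since `f ≤ h` on the stage, equal expectations force equality wherever there
  -- is mass.
  refine le_of_expect_le (hfh k) ?_ hk hs
  exact (le_tsum_shift (A := fun k => expect (d.stage k) h) (B := fun k => expect (d.halt k) g)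
    (d.halt_add_stage_le H hg) htight hfin k).trans
    (tsum_shift_le (A := fun k => expect (d.stage k) f) (d.halt_add_stage_le Hf hgf) k)

theorem expect_result_le {g h : S → ℝ≥0∞} (H : d.Super h)
    (hg : ∀ k s, d.halt k s ≠ 0 → g s ≤ h s) : expect m' g ≤ expect m h := by
  rw [← d.stage_zero, d.expect_result]
  simpa using tsum_shift_le (A := fun k => expect (d.stage k) h) (d.halt_add_stage_le H hg) 0

end Deriv

-- Combinations and compositions of derivations

/-- The closure of the derivations under weighted combinations and composition. -/
inductive Evolves (A : S → PMF S → Prop) : (S → ℝ≥0∞) → (S → ℝ≥0∞) → Prop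
  | deriv {m m' : S → ℝ≥0∞} (d : Deriv A m m') : Evolves A m m'
  | comb {κ : Type u} (c : κ → ℝ≥0∞) {M M' : κ → S → ℝ≥0∞} {m m' : S → ℝ≥0∞}
      (h : ∀ i, c i ≠ 0 → Evolves A (M i) (M' i)) (hm : ∀ s, m s = ∑' i, c i * M i s)
      (hm' : ∀ s, m' s = ∑' i, c i * M' i s) : Evolves A m m'
  | trans {m₁ m₂ m₃ : S → ℝ≥0∞} : Evolves A m₁ m₂ → Evolves A m₂ m₃ → Evolves A m₁ m₃

variable {A : S → PMF S → Prop} {succ : S → Prop}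

theorem expect_le_of_evolves {m m' h : S → ℝ≥0∞}
    (H : ∀ s μ, A s μ → expect μ h ≤ h s) (hE : Evolves A m m') : expect m' h ≤ expect m h := by
  induction hE with
  | deriv d =>
    exact d.expect_result_le (fun k i hi => H _ _ ((d.flow k).trans i hi)) fun _ _ _ => le_rfl
  | comb c _ hm hm' ih =>
    rw [expect_combination hm, expect_combination hm']
    refine ENNReal.tsum_le_tsum fun i => ?_
    by_cases hi : c i = 0
    · simp [hi]
    · exact mul_le_mul_right (ih i hi) _
  | trans _ _ ih₁ ih₂ => exact ih₂.trans ih₁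

theorem Evolves.refl (m : S → ℝ≥0∞) : Evolves A m m :=
  .deriv
    { go := fun _ _ => 0
      halt := fun k s => if k = 0 then m s else 0
      init := by simp
      flow := fun k => by simpa using Flow.zero
      result := fun s => by rw [tsum_eq_single 0] <;> simp +contextual }

theorem Evolves.flow {m m' : S → ℝ≥0∞} (F : Flow A m m') : Evolves A m m' :=
  .deriv
    { go := fun k s => if k = 0 then m s else 0
      halt := fun k s => if k = 1 then m' s else 0
      init := by simp
      flow := fun k =>
        match k with
        | 0 => by simpa using F
        | k + 1 => by simpa using Flow.zero
      result := fun s => by rw [tsum_eq_single 1] <;> simp +contextual }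

-- Value-preserving transitions and the states that they visit

/-- The transitions that preserve the optimal value and stay in `J`. -/
def Conserving (A : S → PMF S → Prop) (succ : S → Prop) (J : S → Prop) (s : S) (μ : PMF S) :
    Prop :=
  A s μ ∧ opt A succ s ≤ expect μ (opt A succ) ∧ ∀ t, μ t ≠ 0 → J t

/-- The states that are visited by derivations which preserve the optimal value and lead to
successful states or to states in `J₀`. -/
inductive Visited (A : S → PMF S → Prop) (succ : S → Prop) (J₀ : S → Prop) : S → Prop
  | base {s : S} : J₀ s → Visited A succ J₀ s
  | succ {s : S} : succ s → Visited A succ J₀ s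
  | visit {m m' : S → ℝ≥0∞} (d : Deriv A m m') (hfin : expect m (opt A succ) ≠ ⊤)
      (htight : expect m (opt A succ) ≤ expect m' (opt A succ))
      (hhalt : ∀ t, m' t ≠ 0 → Visited A succ J₀ t) {k : ℕ} {s : S} (hs : d.stage k s ≠ 0) :
      Visited A succ J₀ s

section Visited

variable {J₀ : S → Prop}

theorem Deriv.super_opt {m m' : S → ℝ≥0∞} (d : Deriv A m m') : d.Super (opt A succ) :=
  fun k i hi => expect_opt_le ((d.flow k).trans i hi)

/-- Tightness makes each transition that is actually used preserve `opt`, and its targets belong to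
the next stage and so are visited. Every such transition is thus available to the restricted
optimum, which is superharmonic along it. -/
theorem Deriv.super_conserving {m m' : S → ℝ≥0∞} (d : Deriv A m m')
    (hfin : expect m (opt A succ) ≠ ⊤)
    (htight : expect m (opt A succ) ≤ expect m' (opt A succ))
    (hhalt : ∀ t, m' t ≠ 0 → Visited A succ J₀ t) :
    d.Super (opt (Conserving A succ (Visited A succ J₀)) succ) := fun k i hi =>
  expect_opt_le ⟨(d.flow k).trans i hi,
    d.le_expect_tgt_of_tight d.super_opt (fun _ _ _ => le_rfl) htight hfin hi,
    fun _ ht => .visit d hfin htight hhalt (k := k + 1) ((d.flow k).tgt_ne_zero hi ht)⟩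

theorem opt_conserving_le (J : S → Prop) (s : S) :
    opt (Conserving A succ J) succ s ≤ opt A succ s :=
  opt_mono_left (fun _ _ h => h.1) s

/-- Equality of the full and the restricted optimum propagates backwards along tight derivations. If
it holds where mass halts, both functions are potentials for the same payments and the full one is
tight, so `Deriv.le_of_tight` gives it at every visited state. -/
theorem opt_le_opt_conserving
    (h₀ : ∀ s, J₀ s → opt A succ s ≤ opt (Conserving A succ (Visited A succ J₀)) succ s) {s : S}
    (hs : Visited A succ J₀ s) :
    opt A succ s ≤ opt (Conserving A succ (Visited A succ J₀)) succ s := by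
  induction hs with
  | base h => exact h₀ _ h
  | succ h => rw [opt_of h, opt_of h]
  | visit d hfin htight hhalt hs ih =>
    exact d.le_of_tight d.super_opt (d.super_conserving hfin htight hhalt) (fun _ _ _ => le_rfl)
      (fun k s h => ih s (d.result_ne_zero h)) htight hfin (fun _ s _ => opt_conserving_le _ s) hs

/-- Tightness is inherited by the constituents: in a combination no component of positive weight can
lose value, since none can gain, and in a composition the intermediate value is squeezed between the
outer ones. This reduces the claim to single derivations. -/
theorem Evolves.visited {m m' : S → ℝ≥0∞} (hE : Evolves A m m')
    (hfin : expect m (opt A succ) ≠ ⊤)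
    (htight : expect m (opt A succ) ≤ expect m' (opt A succ))
    (hJ : ∀ t, m' t ≠ 0 → Visited A succ J₀ t) :
    (∀ s, m s ≠ 0 → Visited A succ J₀ s) ∧
      expect m' (opt (Conserving A succ (Visited A succ J₀)) succ)
        ≤ expect m (opt (Conserving A succ (Visited A succ J₀)) succ) := by
  induction hE with
  | deriv d =>
    refine ⟨fun s hs => .visit d hfin htight hJ (k := 0) (by rwa [d.stage_zero]), ?_⟩
    exact d.expect_result_le (d.super_conserving hfin htight hJ) fun _ _ _ => le_rfl
  | @comb κ c M M' m m' hE hm hm' ih =>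
    rw [expect_combination hm] at hfin htight
    rw [expect_combination hm'] at htight
    have key : ∀ i, c i ≠ 0 → (∀ s, M i s ≠ 0 → Visited A succ J₀ s) ∧
        expect (M' i) (opt (Conserving A succ (Visited A succ J₀)) succ)
          ≤ expect (M i) (opt (Conserving A succ (Visited A succ J₀)) succ) := by
      intro i hi
      refine ih i hi (fun h => ENNReal.ne_top_of_tsum_ne_top hfin i ?_) ?_ fun t ht => hJ t ?_
      · rw [h, ENNReal.mul_top hi]
      · exact le_of_weighted_tsum_le (a := fun i => expect (M i) (opt A succ))
          (b := fun i => expect (M' i) (opt A succ))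
          (fun i hi => expect_le_of_evolves (fun _ _ h => expect_opt_le h) (hE i hi)) htight hfin hi
      · rw [hm']
        exact fun h => mul_ne_zero hi ht (ENNReal.tsum_eq_zero.mp h i)
    constructor
    · intro s hs
      rw [hm] at hs
      by_contra hn
      refine hs (ENNReal.tsum_eq_zero.mpr fun i => ?_)
      by_cases hi : c i = 0
      · simp [hi]
      · by_cases hMs : M i s = 0
        · simp [hMs]
        · exact absurd ((key i hi).1 s hMs) hn
    · rw [expect_combination hm, expect_combination hm']
      refine ENNReal.tsum_le_tsum fun i => ?_
      by_cases hi : c i = 0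
      · simp [hi]
      · exact mul_le_mul_right (key i hi).2 _
  | trans h₁ h₂ ih₁ ih₂ =>
    have l₁ := expect_le_of_evolves (h := opt A succ) (fun _ _ h => expect_opt_le h) h₁
    have l₂ := expect_le_of_evolves (h := opt A succ) (fun _ _ h => expect_opt_le h) h₂
    obtain ⟨v₂, e₂⟩ := ih₂ (ne_top_of_le_ne_top hfin l₁) (l₁.trans htight) hJ
    obtain ⟨v₁, e₁⟩ := ih₁ hfin (htight.trans l₂) v₂
    exact ⟨v₁, e₂.trans e₁⟩

end Visited

-- Couplings, and states that match each other

theorem exists_weight_ne_zero {ι : Type*} {w : ι → ℝ≥0∞} {f : ι → S} {m : S → ℝ≥0∞}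
    (hm : ∀ s, m s = ∑' i, w i * PMF.pure (f i) s) {s : S} (hs : m s ≠ 0) :
    ∃ i, w i ≠ 0 ∧ f i = s := by
  rw [hm] at hs
  by_contra! H
  refine hs (ENNReal.tsum_eq_zero.mpr fun i => ?_)
  by_cases hi : w i = 0
  · simp [hi]
  · simp [PMF.pure_apply, (H i hi).symm]

/-- A decomposition of `m` and `m'` into pairs of states related by `R`. -/
structure Coupling (R : S → S → Prop) (m m' : S → ℝ≥0∞) where
  ι : Type u
  weight : ι → ℝ≥0∞
  fst : ι → S
  snd : ι → S
  rel : ∀ i, weight i ≠ 0 → R (fst i) (snd i)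
  left : ∀ s, m s = ∑' i, weight i * PMF.pure (fst i) s
  right : ∀ s, m' s = ∑' i, weight i * PMF.pure (snd i) s

namespace Coupling

variable {R : S → S → Prop} {m m' : S → ℝ≥0∞} (C : Coupling R m m')
include C

theorem expect_left (h : S → ℝ≥0∞) : expect m h = ∑' i, C.weight i * h (C.fst i) := by
  rw [expect_combination C.left]
  simp_rw [expect_pure]

theorem expect_right (h : S → ℝ≥0∞) : expect m' h = ∑' i, C.weight i * h (C.snd i) := by
  rw [expect_combination C.right]
  simp_rw [expect_pure]

end Coupling

/-- The conditions under which the states on the right do at least as well as the states on the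
left to which they are related. -/
structure Matching (A : S → PMF S → Prop) (succ : S → Prop) (R : S → S → Prop) : Prop where
  success : ∀ {x s}, R x s → succ x →
    ∃ m, Evolves A (PMF.pure s) m ∧ ∑' t, m t = 1 ∧ ∀ t, m t ≠ 0 → succ t
  step : ∀ {x s μ}, R x s → ¬ succ x → A x μ →
    ∃ m, Evolves A (PMF.pure s) m ∧ Nonempty (Coupling R μ m)

namespace Matching

variable {R : S → S → Prop} (hR : Matching A succ R)

/-- The least optimal value of the states related to `x`. -/
def bound (A : S → PMF S → Prop) (succ : S → Prop) (R : S → S → Prop) (x : S) : ℝ≥0∞ :=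
  ⨅ s, ⨅ _ : R x s, opt A succ s

theorem bound_le {x s : S} (h : R x s) : bound A succ R x ≤ opt A succ s := iInf₂_le s h

theorem expect_eq_one {m h : S → ℝ≥0∞} (hm : ∑' t, m t = 1) (hh : ∀ t, m t ≠ 0 → h t = 1) :
    expect m h = 1 := by
  rw [← hm]
  refine tsum_congr fun t => ?_
  by_cases ht : m t = 0
  · simp [ht]
  · simp [hh t ht]

include hR

theorem ind_le_bound (x : S) : ind succ x ≤ bound A succ R x := by
  by_cases hx : succ x
  · refine le_iInf₂ fun s hs => ?_
    obtain ⟨m, hE, hm, hsucc⟩ := hR.success hs hx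
    have := expect_le_of_evolves (h := opt A succ) (fun _ _ h => expect_opt_le h) hE
    rw [expect_pure, expect_eq_one hm fun t ht => opt_of (hsucc t ht)] at this
    exact (ind_le_one x).trans this
  · simp [ind_of_not hx]

/-- The infimum need not be attained, so the estimate is made against every partner `s` of `x`: the
answer from `s` has expected optimum at most `opt A succ s`, and the coupling bounds the expectation
of `bound` by it. -/
theorem expect_bound_le {x : S} {μ : PMF S} (hx : ¬ succ x) (hμ : A x μ) :
    expect μ (bound A succ R) ≤ bound A succ R x := by
  refine le_iInf₂ fun s hs => ?_
  obtain ⟨m, hE, ⟨C⟩⟩ := hR.step hs hx hμ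
  have := expect_le_of_evolves (h := opt A succ) (fun _ _ h => expect_opt_le h) hE
  rw [expect_pure, C.expect_right] at this
  rw [C.expect_left]
  refine le_trans (ENNReal.tsum_le_tsum fun i => ?_) this
  by_cases hi : C.weight i = 0
  · simp [hi]
  · exact mul_le_mul_right (bound_le (C.rel i hi)) _

variable {x₀ : S} {m : S → ℝ≥0∞} (d : Deriv A (PMF.pure x₀) m)
  (hgo : ∀ k s, d.go k s ≠ 0 → ¬ succ s)

include hgo

theorem super_bound : d.Super (bound A succ R) := fun k i hi =>
  hR.expect_bound_le (hgo k _ ((d.flow k).src_ne_zero hi)) ((d.flow k).trans i hi)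

theorem expect_ind_le {s₀ : S} (h₀ : R x₀ s₀) : expect m (ind succ) ≤ opt A succ s₀ := by
  have := d.expect_result_le (hR.super_bound d hgo) fun _ s _ => hR.ind_le_bound s
  rw [expect_pure] at this
  exact this.trans (bound_le h₀)

/-- If the value of a derivation on the left is the optimal value on the right, then the optimal
value on the right is still optimal for value-preserving transitions among visited states. -/
theorem exists_conserving {s₀ : S} (h₀ : R x₀ s₀) (hopt : opt A succ s₀ ≤ expect m (ind succ)) :
    ∃ J : S → Prop, J s₀ ∧ ∀ s, J s → opt A succ s ≤ opt (Conserving A succ J) succ s := by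
  set u := bound A succ R with hu
  -- The partners of visited left states at which the infimum `u` is attained; the inequality is an
  -- equality by `bound_le`.
  let J₀ : S → Prop := fun s => ∃ k x, d.stage k x ≠ 0 ∧ R x s ∧ opt A succ s ≤ u x
  set J := Visited A succ J₀ with hJ
  set ψ := opt (Conserving A succ J) succ with hψ
  have hsup := hR.super_bound d hgo
  have hind : ∀ k s, d.halt k s ≠ 0 → ind succ s ≤ u s := fun _ s _ => hR.ind_le_bound s
  have htight : expect (PMF.pure x₀) u ≤ expect m (ind succ) := by
    rw [expect_pure]
    exact (bound_le h₀).trans hopt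
  have hfin : expect (PMF.pure x₀) u ≠ ⊤ := by
    rw [expect_pure]
    exact ne_top_of_le_ne_top (opt_ne_top s₀) (bound_le h₀)
  have hs₀ : J₀ s₀ := by
    refine ⟨0, x₀, by simp [d.stage_zero], h₀, ?_⟩
    have := d.expect_result_le hsup hind
    rw [expect_pure] at this
    exact hopt.trans this
  -- value-preserving moves on the left are matched by value-preserving moves on the right
  have match_step : ∀ k i, (d.flow k).weight i ≠ 0 → ∀ s, R ((d.flow k).src i) s →
      opt A succ s ≤ u ((d.flow k).src i) → ∃ m', Evolves A (PMF.pure s) m' ∧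
        ∃ C : Coupling R ((d.flow k).tgt i) m', opt A succ s ≤ expect m' (opt A succ) ∧
          ∀ j, C.weight j ≠ 0 → d.stage (k + 1) (C.fst j) ≠ 0 ∧
            opt A succ (C.snd j) ≤ u (C.fst j) := by
    intro k i hi s hs hle
    obtain ⟨m', hE, ⟨C⟩⟩ := hR.step hs (hgo k _ ((d.flow k).src_ne_zero hi)) ((d.flow k).trans i hi)
    have h1 := expect_le_of_evolves (h := opt A succ) (fun _ _ h => expect_opt_le h) hE
    rw [expect_pure] at h1
    have h2 : u ((d.flow k).src i) ≤ expect ((d.flow k).tgt i) u :=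
      d.le_expect_tgt_of_tight hsup hind htight hfin hi
    have h3 : expect ((d.flow k).tgt i) u ≤ expect m' (opt A succ) := by
      rw [C.expect_left, C.expect_right]
      refine ENNReal.tsum_le_tsum fun j => ?_
      by_cases hj : C.weight j = 0
      · simp [hj]
      · exact mul_le_mul_right (bound_le (C.rel j hj)) _
    refine ⟨m', hE, C, (hle.trans h2).trans h3, fun j hj => ⟨?_, ?_⟩⟩
    · refine (d.flow k).tgt_ne_zero hi ?_
      rw [C.left]
      exact fun h => hj (by simpa using ENNReal.tsum_eq_zero.mp h j)
    · refine le_of_weighted_tsum_le (p := C.weight) (a := fun j => opt A succ (C.snd j))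
        (b := fun j => u (C.fst j)) (fun j hj => bound_le (C.rel j hj)) ?_ ?_ hj
      · rw [← C.expect_left, ← C.expect_right]
        exact (h1.trans hle).trans h2
      · rw [← C.expect_right]
        exact ne_top_of_le_ne_top (opt_ne_top s) h1
  -- Every visited left state has a partner that attains `u`. Without one, the infimum `v` below
  -- would be `⊤` and `v ≤ u` would fail.
  have exists_rel : ∀ k x, d.stage k x ≠ 0 → ∃ s, R x s ∧ opt A succ s ≤ u x := by
    intro k
    induction k with
    | zero =>
      intro x hx
      rw [d.stage_zero] at hx
      have : x = x₀ := by simpa using hx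
      obtain ⟨k, x, hx', hr, hle⟩ := hs₀
      subst this
      refine ⟨s₀, h₀, ?_⟩
      have := d.expect_result_le hsup hind
      rw [expect_pure] at this
      exact hopt.trans this
    | succ k ih =>
      intro y hy
      obtain ⟨i, hi, hiy⟩ := (d.flow k).exists_of_ne_zero hy
      obtain ⟨s, hs, hle⟩ := ih _ (d.stage_ne_zero_of_go ((d.flow k).src_ne_zero hi))
      obtain ⟨m', -, C, -, hC⟩ := match_step k i hi s hs hle
      obtain ⟨j, hj, rfl⟩ := exists_weight_ne_zero C.left hiy
      exact ⟨C.snd j, C.rel j hj, (hC j hj).2⟩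
  -- The analogue of `u` for the restricted optimum, with the infimum over the partners that attain
  -- `u` only, since their answers to the moves of `d` are tight. It is a second potential for the
  -- same derivation, with the same payments as `u`.
  let v : S → ℝ≥0∞ := fun x => ⨅ s, ⨅ _ : R x s ∧ opt A succ s ≤ u x, ψ s
  have v_le : ∀ {x s}, R x s → opt A succ s ≤ u x → v x ≤ ψ s := fun h1 h2 => iInf₂_le _ ⟨h1, h2⟩
  have hvsup : d.Super v := by
    intro k i hi
    refine le_iInf₂ fun s hs => ?_
    obtain ⟨m', hE, C, hle, hC⟩ := match_step k i hi s hs.1 hs.2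
    have := (hE.visited (J₀ := J₀) (succ := succ) (by rw [expect_pure]; exact opt_ne_top s)
      (by rwa [expect_pure]) fun t ht => by
        obtain ⟨j, hj, rfl⟩ := exists_weight_ne_zero C.right ht
        exact .base ⟨k + 1, C.fst j, (hC j hj).1, C.rel j hj, (hC j hj).2⟩).2
    rw [expect_pure, C.expect_right] at this
    rw [C.expect_left]
    refine le_trans (ENNReal.tsum_le_tsum fun j => ?_) this
    by_cases hj : C.weight j = 0
    · simp [hj]
    · exact mul_le_mul_right (v_le (C.rel j hj) (hC j hj).2) _
  have hvind : ∀ k s, d.halt k s ≠ 0 → ind succ s ≤ v s := by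
    intro k x _
    by_cases hx : succ x
    · refine le_iInf₂ fun s hs => ?_
      obtain ⟨m', hE, hm, hsucc⟩ := hR.success hs.1 hx
      have := (hE.visited (J₀ := J₀) (succ := succ) (by rw [expect_pure]; exact opt_ne_top s)
        (by
          rw [expect_pure, expect_eq_one hm fun t ht => opt_of (hsucc t ht)]
          exact opt_le_one s) fun t ht => .succ (hsucc t ht)).2
      rw [expect_pure, expect_eq_one hm fun t ht => opt_of (hsucc t ht)] at this
      exact (ind_le_one x).trans this
    · simp [ind_of_not hx]
  have hvu : ∀ k x, d.stage k x ≠ 0 → v x ≤ u x := by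
    intro k x hx
    obtain ⟨s, hs, hle⟩ := exists_rel k x hx
    exact ((v_le hs hle).trans (opt_conserving_le J s)).trans hle
  refine ⟨J, .base hs₀, fun s hs => opt_le_opt_conserving ?_ hs⟩
  rintro s ⟨k, x, hx, hr, hle⟩
  -- Now `u` is a tight potential and `v ≤ u`, so they agree on visited states, and `opt A succ s ≤
  -- u x ≤ v x ≤ ψ s`.
  exact (hle.trans (d.le_of_tight hsup hvsup hind hvind htight hfin hvu hx)).trans (v_le hr hle)

end Matching

end Derivations

/-! ### Derivations that follow a policy with memory -/

section Policy

variable {S : Type u} {Act : Type v} (P : PLTS S Act) {C : Type*} (mv : S × C → PMF S)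
  (nx : S × C → S → C)

/-- A state from which a policy continues. -/
def Continues (x : S × C) : Prop := ¬ P.success x.1 ∧ ∃ μ, P.trans x.1 P.tau μ

/-- The transition kernel of a policy, which chooses a transition and updates the memory. -/
def kernel (x : S × C) : PMF (S × C) := (mv x).map fun t => (t, nx x t)

open Classical in
/-- The probability of success within `k` transitions of the policy. -/
def hit : ℕ → S × C → ℝ≥0∞
  | 0, x => ind P.success x.1
  | k + 1, x => if Continues P x then expect (kernel mv nx x) (hit k) else ind P.success x.1

open Classical in
/-- The restriction of `m` to the states where `p` holds. -/
def restrict {X : Type*} (p : X → Prop) (m : X → ℝ≥0∞) (x : X) : ℝ≥0∞ := if p x then m x else 0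

/-- The distribution after `k` transitions of the policy, among the runs that continue. -/
def occ (x₀ : S × C) : ℕ → S × C → ℝ≥0∞
  | 0 => PMF.pure x₀
  | k + 1 => fun y => ∑' x, restrict (Continues P) (occ x₀ k) x * kernel mv nx x y

/-- The marginal weights on states. -/
def proj (m : S × C → ℝ≥0∞) (s : S) : ℝ≥0∞ := expect m fun x => PMF.pure x.1 s

theorem expect_restrict_add {X : Type*} (p : X → Prop) (m h : X → ℝ≥0∞) :
    expect (restrict p m) h + expect (restrict (fun x => ¬ p x) m) h = expect m h := by
  rw [← expect_add]
  congr
  funext x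
  by_cases hx : p x <;> simp [restrict, hx]

theorem expect_proj (m : S × C → ℝ≥0∞) (h : S → ℝ≥0∞) :
    expect (proj m) h = expect m fun x => h x.1 := by
  rw [expect_combination (m := proj m) (p := m) (M := fun x => PMF.pure x.1) fun s => rfl]
  simp_rw [expect_pure]
  rfl

variable {mv nx}

theorem proj_ne_zero {m : S × C → ℝ≥0∞} {s : S} (h : proj m s ≠ 0) : ∃ c, m (s, c) ≠ 0 := by
  obtain ⟨x, hx, rfl⟩ := exists_weight_ne_zero (m := proj m) (w := m) (f := Prod.fst)
    (fun _ => rfl) h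
  exact ⟨x.2, hx⟩

variable {P} {x₀ : S × C}

theorem expect_occ_succ (k : ℕ) (h : S × C → ℝ≥0∞) :
    expect (occ P mv nx x₀ (k + 1)) h =
      expect (restrict (Continues P) (occ P mv nx x₀ k)) fun x => expect (kernel mv nx x) h :=
  expect_combination fun _ => rfl

theorem expect_kernel (x : S × C) (h : S × C → ℝ≥0∞) :
    expect (kernel mv nx x) h = expect (mv x) fun t => h (t, nx x t) :=
  expect_map _ _ _

theorem proj_occ_succ (k : ℕ) (s : S) :
    proj (occ P mv nx x₀ (k + 1)) s =
      expect (restrict (Continues P) (occ P mv nx x₀ k)) fun x => mv x s := by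
  rw [proj, expect_occ_succ]
  congr
  funext x
  rw [expect_kernel]
  have := PMF.bind_apply (mv x) PMF.pure s
  rw [PMF.bind_pure] at this
  exact this.symm

theorem mass_occ (k : ℕ) :
    expect (restrict (fun x => ¬ Continues P x) (occ P mv nx x₀ k)) (fun _ => 1)
      + expect (occ P mv nx x₀ (k + 1)) (fun _ => 1) = expect (occ P mv nx x₀ k) fun _ => 1 := by
  rw [expect_occ_succ, ← expect_restrict_add (Continues P) (occ P mv nx x₀ k), add_comm]
  simp_rw [expect_pmf_const]

theorem mass_occ_le (k : ℕ) : expect (occ P mv nx x₀ k) (fun _ => 1) ≤ 1 := by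
  refine (antitone_of_shift_le (fun k => (mass_occ (x₀ := x₀) k).le) k).trans ?_
  rw [occ, expect_pure]

/-- Success within `k` further transitions is observed only where a run has stopped, so it is
accounted for by the mass that stops at the times `j` to `j + k`. -/
theorem expect_occ_hit_le (j k : ℕ) :
    expect (occ P mv nx x₀ j) (hit P mv nx k) ≤ ∑ i ∈ Finset.range (k + 1),
      expect (restrict (fun x => ¬ Continues P x) (occ P mv nx x₀ (j + i)))
        fun x => ind P.success x.1 := by
  induction k generalizing j with
  | zero =>
    rw [← expect_restrict_add (Continues P)]
    have : expect (restrict (Continues P) (occ P mv nx x₀ j)) (hit P mv nx 0) = 0 := by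
      refine ENNReal.tsum_eq_zero.mpr fun x => ?_
      by_cases hx : Continues P x
      · simp [hit, ind_of_not hx.1]
      · simp [restrict, hx]
    rw [this]
    simp [hit]
  | succ k ih =>
    rw [← expect_restrict_add (Continues P), Finset.sum_range_succ', add_zero]
    refine add_le_add ?_ ?_
    · refine le_trans ?_ ((ih (j + 1)).trans (by simp [add_assoc, add_comm 1]))
      rw [expect_occ_succ]
      refine expect_mono fun x hx => ?_
      have : Continues P x := by
        by_contra h
        simp [restrict, h] at hx
      simp [hit, this]
    · refine expect_mono fun x hx => ?_
      have : ¬ Continues P x := by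
        intro h
        simp [restrict, h] at hx
      simp [hit, this]

theorem restrict_ne_zero {X : Type*} {p : X → Prop} {m : X → ℝ≥0∞} {x : X}
    (h : restrict p m x ≠ 0) : p x ∧ m x ≠ 0 := by
  unfold restrict at h
  split at h
  · exact ⟨‹_›, h⟩
  · exact absurd rfl h

/-- Lifted transitions are finite combinations, so each stage of a policy must be shown to be
finitely supported before it can serve as a stage of a hyper-derivation. -/
theorem finite_occ (hmv : ∀ x, Continues P x → (mv x).support.Finite) (k : ℕ) :
    {x | occ P mv nx x₀ k x ≠ 0}.Finite := by
  induction k with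
  | zero => exact (Set.finite_singleton x₀).subset fun x hx => by simpa [occ] using hx
  | succ k ih =>
    refine (Set.Finite.biUnion
      (s := {x | restrict (Continues P) (occ P mv nx x₀ k) x ≠ 0})
      (t := fun x => (kernel mv nx x).support)
      (ih.subset fun x hx => (restrict_ne_zero hx).2) ?_).subset ?_
    · intro x hx
      rw [kernel, PMF.support_map]
      exact (hmv x (restrict_ne_zero hx).1).image _
    · intro y hy
      by_contra hn
      refine hy (ENNReal.tsum_eq_zero.mpr fun x => ?_)
      by_cases hx : restrict (Continues P) (occ P mv nx x₀ k) x = 0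
      · simp [hx]
      · have : kernel mv nx x y = 0 := by
          by_contra hxy
          exact hn (Set.mem_biUnion hx hxy)
        simp [this]

theorem expect_eq_sum_fin {X : Type*} {m : X → ℝ≥0∞} {F : Finset X} (hF : ∀ x, m x ≠ 0 → x ∈ F)
    (h : X → ℝ≥0∞) :
    expect m h = ∑ i : Fin F.card, m (F.equivFin.symm i) * h (F.equivFin.symm i) := by
  rw [expect, tsum_eq_sum (s := F), ← Finset.sum_coe_sort F, ← F.equivFin.symm.sum_comp]
  intro x hx
  by_cases hm : m x = 0
  · simp [hm]
  · exact absurd (hF x hm) hx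

theorem tsum_proj (m : S × C → ℝ≥0∞) : ∑' s, proj m s = expect m fun _ => 1 := by
  rw [← expect_proj m fun _ => 1, expect_const, mul_one]

theorem mass_restrict_le (p : S × C → Prop) (k : ℕ) :
    ∑' s, proj (restrict p (occ P mv nx x₀ k)) s ≤ 1 := by
  rw [tsum_proj]
  refine le_trans ?_ (mass_occ_le (P := P) (mv := mv) (nx := nx) (x₀ := x₀) k)
  rw [← expect_restrict_add p (occ P mv nx x₀ k)]
  exact le_self_add

open Classical in
/-- A policy leads to an extreme derivation that is at least as successful as the policy. -/
theorem exists_extreme_of_policy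
    (hmv : ∀ x, Continues P x → P.trans x.1 P.tau (mv x) ∧ (mv x).support.Finite) (x₀ : S × C) :
    ∃ q ∈ P.Results (SubDist.point x₀.1), ∀ k, hit P mv nx k x₀ ≤ q := by
  -- The run moves exactly where it can continue and the memory is forgotten by projection. Mass
  -- halts only at states that are successful or have no internal transition, which is what
  -- extremeness demands.
  let go : ℕ → SubDist S := fun k =>
    ⟨proj (restrict (Continues P) (occ P mv nx x₀ k)), mass_restrict_le _ k⟩
  let halt : ℕ → SubDist S := fun k =>
    ⟨proj (restrict (fun x => ¬ Continues P x) (occ P mv nx x₀ k)), mass_restrict_le _ k⟩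
  have hadd : ∀ k s, go k s + halt k s = proj (occ P mv nx x₀ k) s := fun k s =>
    expect_restrict_add _ _ _
  have hmass : ∑' s, ∑' k, halt k s ≤ 1 := by
    rw [ENNReal.tsum_comm]
    have h := tsum_shift_le (fun k => (mass_occ (P := P) (mv := mv) (nx := nx) (x₀ := x₀) k).le) 0
    refine le_trans ?_ (h.trans (mass_occ_le 0))
    refine ENNReal.tsum_le_tsum fun k => ?_
    rw [zero_add]
    exact (tsum_proj _).le
  let res : SubDist S := ⟨fun s => ∑' k, halt k s, hmass⟩
  have hres : ∀ h, expect res h =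
      ∑' k, expect (restrict (fun x => ¬ Continues P x) (occ P mv nx x₀ k)) fun x => h x.1 := by
    intro h
    change expect (fun s => ∑' k, halt k s) h = _
    rw [expect_tsum fun k => halt k]
    exact tsum_congr fun k => expect_proj _ _
  refine ⟨P.value res, ⟨res, ⟨⟨go, halt, ?_, ?_, ?_, fun s => rfl⟩, ?_⟩, rfl⟩, ?_⟩
  · intro s
    rw [hadd, proj, occ, expect_pure]
    rfl
  · intro k
    refine ⟨⟨proj (occ P mv nx x₀ (k + 1)), by rw [tsum_proj]; exact mass_occ_le _⟩, ?_,
      fun s => (hadd (k + 1) s).symm⟩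
    have hfin := finite_occ (nx := nx) (x₀ := x₀) (fun x hx => (hmv x hx).2) k
    -- `Lift.comb` asks for a transition at every index, including those of weight zero, so the
    -- index set keeps only states from which the policy continues.
    set F : Finset (S × C) := {x ∈ hfin.toFinset | Continues P x} with hF
    have hmem : ∀ x, restrict (Continues P) (occ P mv nx x₀ k) x ≠ 0 → x ∈ F := fun x hx => by
      simpa [hF] using (restrict_ne_zero hx).symm
    refine Lift.comb (n := F.card)
      (fun i => restrict (Continues P) (occ P mv nx x₀ k) (F.equivFin.symm i))
      (fun i => SubDist.point (F.equivFin.symm i : S × C).1)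
      (fun i => SubDist.ofPMF (mv (F.equivFin.symm i))) _ _ ?_ ?_ ?_ ?_
    · have := expect_eq_sum_fin hmem fun _ => 1
      simp only [mul_one] at this
      rw [← this, ← tsum_proj]
      exact mass_restrict_le _ k
    · intro i
      have : Continues P (F.equivFin.symm i : S × C) :=
        (Finset.mem_filter.mp (F.equivFin.symm i).2).2
      exact .base ⟨_, (hmv _ this).1, rfl⟩
    · exact fun s => expect_eq_sum_fin hmem _
    · intro s
      exact (proj_occ_succ k s).trans (expect_eq_sum_fin hmem _)
  · intro k s hs
    obtain ⟨c, hc⟩ := proj_ne_zero hs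
    exact (restrict_ne_zero hc).1.1
  · intro s hs hμ
    by_contra hsucc
    refine hs (ENNReal.tsum_eq_zero.mpr fun k => ?_)
    by_contra hk
    obtain ⟨c, hc⟩ := proj_ne_zero hk
    exact (restrict_ne_zero hc).1 ⟨hsucc, hμ⟩
  · intro k
    have hval : P.value res = expect res (ind P.success) := by
      refine tsum_congr fun s => ?_
      by_cases hs : P.success s <;> simp [ind, hs]
    rw [hval, hres]
    have := expect_occ_hit_le (P := P) (mv := mv) (nx := nx) (x₀ := x₀) 0 k
    rw [occ, expect_pure] at this
    simp only [zero_add] at this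
    exact this.trans (ENNReal.sum_le_tsum _)

variable (P mv nx) in
/-- The probability that the policy succeeds. -/
def hitProb (x : S × C) : ℝ≥0∞ := ⨆ k, hit P mv nx k x

theorem hit_le_succ (k : ℕ) (x : S × C) : hit P mv nx k x ≤ hit P mv nx (k + 1) x := by
  induction k generalizing x with
  | zero =>
    by_cases hx : Continues P x
    · simp [hit, ind_of_not hx.1]
    · simp [hit, hx]
  | succ k ih =>
    by_cases hx : Continues P x
    · rw [hit, hit, if_pos hx, if_pos hx]
      exact expect_mono fun y _ => ih y
    · simp [hit, hx]

theorem hitProb_of_success {x : S × C} (hx : P.success x.1) : hitProb P mv nx x = 1 := by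
  have h : ∀ k, hit P mv nx k x = 1 := fun k => by
    cases k <;> simp [hit, Continues, hx, ind_of hx]
  simp [hitProb, h]

theorem hitProb_of_continues {x : S × C} (hx : Continues P x) :
    hitProb P mv nx x = expect (mv x) fun t => hitProb P mv nx (t, nx x t) := by
  rw [← expect_kernel x (hitProb P mv nx)]
  unfold hitProb
  rw [expect_iSup fun y => monotone_nat_of_le_succ fun k => hit_le_succ k y,
    ← (monotone_nat_of_le_succ fun k => hit_le_succ k x).iSup_nat_add 1]
  simp [hit, hx]

end Policy

/-! ### Policies that attain the optimal value -/

section Attain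

variable {S : Type u} {Act : Type v} {P : PLTS S Act} {A : S → PMF S → Prop}

variable (A) in
/-- The value `c.2` can be exceeded from `s` within `c.1` transitions, or is zero. -/
def Feasible (succ : S → Prop) (s : S) (c : ℕ × ℝ≥0∞) : Prop :=
  c.2 < optN A succ c.1 s ∨ c.2 = 0

variable (A) in
/-- A choice of a transition, and of the values that are aimed at from its targets, which makes
progress: if no value is aimed at, then at least half of the optimal value is aimed at next. -/
structure Progress (succ : S → Prop) (s : S) (c : ℕ × ℝ≥0∞) (μ : PMF S) (f : S → ℕ × ℝ≥0∞) :
    Prop where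
  trans : A s μ
  feasible : ∀ t, Feasible A succ t (f t)
  le : c.2 ≤ expect μ fun t => (f t).2
  half : c.2 = 0 → opt A succ s ≤ 2 * expect μ fun t => (f t).2
  rank : c.2 ≠ 0 → ∀ t, (f t).1 + 1 = c.1

/-- Some transition has an expected `optN k` value above `b`. Scaling `optN k` down by a common
factor below one makes the expectation exactly `b` and leaves the new aims strictly feasible
wherever they are not zero. -/
theorem exists_feasible_step {succ : S → Prop} {s : S} (hs : ¬ succ s) {n : ℕ} {b : ℝ≥0∞}
    (hb : b < optN A succ n s) :
    ∃ k, n = k + 1 ∧ ∃ μ, A s μ ∧ ∃ f : S → ℝ≥0∞,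
      (∀ t, Feasible A succ t (k, f t)) ∧ expect μ f = b := by
  obtain _ | k := n
  · simp [optN, ind_of_not hs] at hb
  rw [optN_succ_of_not hs] at hb
  obtain ⟨μ, hb⟩ := lt_iSup_iff.mp hb
  obtain ⟨hμ, hb⟩ := lt_iSup_iff.mp hb
  set E := expect μ (optN A succ k) with hE
  have hE0 : E ≠ 0 := ne_bot_of_gt hb
  have hE1 : E ≠ ⊤ := ne_top_of_le_ne_top ENNReal.one_ne_top (expect_pmf_le (optN_le_one k))
  refine ⟨k, rfl, μ, hμ, fun t => b / E * optN A succ k t, fun t => ?_, ?_⟩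
  · by_cases ht : optN A succ k t = 0
    · right
      simp [ht]
    · left
      have h1 : b / E < 1 := (ENNReal.div_lt_iff (Or.inl hE0) (Or.inl hE1)).mpr (by simpa using hb)
      have h2 : optN A succ k t ≠ ⊤ := ne_top_of_le_ne_top ENNReal.one_ne_top (optN_le_one k t)
      simpa using (ENNReal.mul_lt_mul_iff_left ht h2).mpr h1
  · rw [expect_mul_right, ← hE, ENNReal.div_mul_cancel hE0 hE1]

/-- A positive aim is passed on unchanged in expectation with one transition fewer. With aim zero a
new round starts: half of the positive optimum is strictly below it, hence below `optN` for some
horizon. -/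
theorem exists_progress {succ : S → Prop} {s : S} (hs : ¬ succ s) {c : ℕ × ℝ≥0∞}
    (hc : Feasible A succ s c) (hopt : c.2 = 0 → opt A succ s ≠ 0) :
    ∃ μ f, Progress A succ s c μ f := by
  by_cases h0 : c.2 = 0
  · have hlt : opt A succ s / 2 < opt A succ s := ENNReal.half_lt_self (hopt h0) (opt_ne_top s)
    obtain ⟨n, hn⟩ := lt_iSup_iff.mp (show opt A succ s / 2 < ⨆ n, optN A succ n s from hlt)
    obtain ⟨k, rfl, μ, hμ, f, hf, hE⟩ := exists_feasible_step hs hn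
    refine ⟨μ, fun t => (k, f t), hμ, hf, by simp [h0], fun _ => ?_, fun h => absurd h0 h⟩
    change _ ≤ 2 * expect μ f
    rw [hE, ENNReal.mul_div_cancel (by simp) (by simp)]
  · obtain ⟨k, hk, μ, hμ, f, hf, hE⟩ := exists_feasible_step hs (hc.resolve_right h0)
    exact ⟨μ, fun t => (k, f t), hμ, hf, hE.ge, fun h => absurd h h0, fun _ _ => hk.symm⟩

variable (P A) in
open Classical in
/-- A policy which makes progress wherever possible, and makes some transition otherwise. -/
def progressPolicy (x : S × (ℕ × ℝ≥0∞)) : PMF S × (S → ℕ × ℝ≥0∞) :=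
  if h : ∃ y : PMF S × (S → ℕ × ℝ≥0∞), Progress A P.success x.1 x.2 y.1 y.2 then h.choose
  else if h : ∃ μ, P.trans x.1 P.tau μ then (h.choose, fun _ => (0, 0))
  else (PMF.pure x.1, fun _ => (0, 0))

theorem progressPolicy_spec {x : S × (ℕ × ℝ≥0∞)} {μ : PMF S} {f : S → ℕ × ℝ≥0∞}
    (h : Progress A P.success x.1 x.2 μ f) :
    Progress A P.success x.1 x.2 (progressPolicy P A x).1 (progressPolicy P A x).2 := by
  have h' : ∃ y : PMF S × (S → ℕ × ℝ≥0∞), Progress A P.success x.1 x.2 y.1 y.2 := ⟨(μ, f), h⟩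
  rw [progressPolicy, dif_pos h']
  exact h'.choose_spec

theorem progressPolicy_trans (hA : ∀ s μ, A s μ → P.trans s P.tau μ) {x : S × (ℕ × ℝ≥0∞)}
    (hx : Continues P x) : P.trans x.1 P.tau (progressPolicy P A x).1 := by
  unfold progressPolicy
  split_ifs with h h'
  · exact hA _ _ h.choose_spec.trans
  · exact h'.choose_spec
  · exact absurd hx.2 h'

variable (P A) in
/-- The probability that the progressing policy succeeds. -/
def progressProb (x : S × (ℕ × ℝ≥0∞)) : ℝ≥0∞ :=
  hitProb P (fun x => (progressPolicy P A x).1) (fun x => (progressPolicy P A x).2) x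

variable (hA : ∀ s μ, A s μ → P.trans s P.tau μ)
include hA

theorem exists_progress_step {s : S} (hs : ¬ P.success s) {c : ℕ × ℝ≥0∞}
    (hc : Feasible A P.success s c) (hopt : c.2 = 0 → opt A P.success s ≠ 0) :
    ∃ μ f, Progress A P.success s c μ f ∧
      progressProb P A (s, c) = expect μ fun t => progressProb P A (t, f t) := by
  obtain ⟨μ, f, h⟩ := exists_progress hs hc hopt
  have hp := progressPolicy_spec (x := (s, c)) h
  exact ⟨_, _, hp, hitProb_of_continues ⟨hs, _, hA _ _ hp.trans⟩⟩

/-- Induction on the horizon: a positive aim is preserved in expectation by each step, and once the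
horizon is used up a feasible aim is zero unless success has been reached. -/
theorem le_progressProb {s : S} {c : ℕ × ℝ≥0∞} (hc : Feasible A P.success s c) :
    c.2 ≤ progressProb P A (s, c) := by
  obtain ⟨n, b⟩ := c
  induction n generalizing s b with
  | zero =>
    by_cases hs : P.success s
    · rw [progressProb, hitProb_of_success hs]
      exact hc.elim (fun h => h.le.trans (optN_le_one _ _)) fun h => h.le.trans zero_le_one
    · rcases hc with h | h
      · simp [optN, ind_of_not hs] at h
      · exact h.le.trans zero_le
  | succ n ih =>
    by_cases hs : P.success s
    · rw [progressProb, hitProb_of_success hs]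
      exact hc.elim (fun h => h.le.trans (optN_le_one _ _)) fun h => h.le.trans zero_le_one
    · by_cases hb : b = 0
      · simp [hb]
      · obtain ⟨μ, f, hp, he⟩ := exists_progress_step hA hs hc fun h => absurd h hb
        rw [he]
        refine hp.le.trans (expect_mono fun t _ => ?_)
        have hr : (f t).1 = n := by simpa using hp.rank hb t
        have := ih (s := t) (b := (f t).2) (by rw [← hr]; exact hp.feasible t)
        rwa [← hr] at this

variable {J : S → Prop} (hJ : ∀ s μ, J s → A s μ →
  (∀ t, μ t ≠ 0 → J t) ∧ opt A P.success s ≤ expect μ (opt A P.success))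
include hJ

omit hA in
-- The inequality says that the deficit, optimum minus success probability, is at most `a` times the
-- optimum minus the aim; it is written additively because subtraction truncates. It averages over
-- the targets because the chosen transition preserves the optimum.
theorem step_bound {a : ℝ≥0∞} {s : S} (hs : J s) {c : ℕ × ℝ≥0∞} {μ : PMF S} {f : S → ℕ × ℝ≥0∞}
    (hp : Progress A P.success s c μ f)
    (he : progressProb P A (s, c) = expect μ fun t => progressProb P A (t, f t))
    (ih : ∀ t, J t → opt A P.success t + a * (f t).2
      ≤ progressProb P A (t, f t) + a * opt A P.success t) :
    opt A P.success s + a * expect μ (fun t => (f t).2)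
      ≤ progressProb P A (s, c) + a * opt A P.success s := by
  obtain ⟨h1, h2⟩ := hJ s μ hs hp.trans
  calc opt A P.success s + a * expect μ (fun t => (f t).2)
      ≤ expect μ (opt A P.success) + a * expect μ (fun t => (f t).2) := add_le_add_left h2 _
    _ = expect μ (fun t => opt A P.success t + a * (f t).2) := by
      rw [expect_add_right, expect_mul_right]
    _ ≤ expect μ (fun t => progressProb P A (t, f t) + a * opt A P.success t) :=
      expect_mono fun t ht => ih t (h1 t ht)
    _ = progressProb P A (s, c) + a * expect μ (opt A P.success) := by
      rw [expect_add_right, expect_mul_right, he]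
    _ ≤ _ := add_le_add_right (mul_le_mul_right (expect_opt_le hp.trans) _) _

/-- Extends the deficit bound from aim zero to any feasible aim, by induction on the horizon: each
step hands the aim on to the targets, until success or aim zero is reached. -/
theorem feasible_bound {a : ℝ≥0∞}
    (h0 : ∀ s n, J s → opt A P.success s ≤ progressProb P A (s, (n, 0)) + a * opt A P.success s)
    {s : S} (hs : J s) {c : ℕ × ℝ≥0∞} (hc : Feasible A P.success s c) :
    opt A P.success s + a * c.2 ≤ progressProb P A (s, c) + a * opt A P.success s := by
  obtain ⟨n, b⟩ := c
  have hsucc : ∀ {s n b}, P.success s → Feasible A P.success s (n, b) →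
      opt A P.success s + a * b ≤ progressProb P A (s, (n, b)) + a * opt A P.success s := by
    intro s n b h hc
    rw [progressProb, hitProb_of_success h, opt_of h]
    have : b ≤ 1 := hc.elim (fun h => h.le.trans (optN_le_one _ _)) fun h => by
      rw [show b = 0 from h]
      exact zero_le_one
    exact add_le_add_right (mul_le_mul_right this a) 1
  induction n generalizing s b with
  | zero =>
    by_cases h : P.success s
    · exact hsucc h hc
    · rcases hc with h' | h'
      · simp [optN, ind_of_not h] at h'
      · have : b = 0 := h'
        subst this
        simpa using h0 s 0 hs
  | succ n ih =>
    by_cases h : P.success s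
    · exact hsucc h hc
    · by_cases hb : b = 0
      · subst hb
        simpa using h0 s (n + 1) hs
      · obtain ⟨μ, f, hp, he⟩ := exists_progress_step hA h hc fun h => absurd h hb
        refine le_trans (add_le_add_right (mul_le_mul_right hp.le a) _)
          (step_bound hJ hs hp he fun t ht => ?_)
        have hr : (f t).1 = n := by simpa using hp.rank hb t
        have := ih (s := t) ht (b := (f t).2) (by rw [← hr]; exact hp.feasible t)
        rwa [← hr] at this

/-- Each new round halves the deficit: its first step aims at no less than half of the optimum, so
by `feasible_bound` with factor `2⁻¹ ^ k` the deficit is at most `2⁻¹ ^ k` times the other half. -/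
theorem opt_le_add_half_pow (k : ℕ) {s : S} (n : ℕ) (hs : J s) :
    opt A P.success s ≤ progressProb P A (s, (n, 0)) + 2⁻¹ ^ k * opt A P.success s := by
  induction k generalizing s n with
  | zero => simp
  | succ k ih =>
    have hfin := opt_ne_top (A := A) (succ := P.success) s
    by_cases h : P.success s
    · rw [progressProb, hitProb_of_success h, opt_of h]
      exact le_self_add
    by_cases h0 : opt A P.success s = 0
    · simp [h0]
    obtain ⟨μ, f, hp, he⟩ := exists_progress_step hA h (c := (n, 0)) (Or.inr rfl) fun _ => h0
    have key := step_bound hJ hs hp he fun t ht =>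
      feasible_bound hA hJ (fun s n hs => ih n hs) ht (hp.feasible t)
    have hhalf : 2⁻¹ ^ (k + 1) * opt A P.success s ≤ 2⁻¹ ^ k * expect μ (fun t => (f t).2) := by
      rw [pow_succ, mul_assoc]
      refine mul_le_mul_right ?_ _
      calc 2⁻¹ * opt A P.success s ≤ 2⁻¹ * (2 * expect μ fun t => (f t).2) :=
            mul_le_mul_right (hp.half rfl) _
        _ = _ := by rw [← mul_assoc, ENNReal.inv_mul_cancel (by simp) (by simp), one_mul]
    have hsplit : (2⁻¹ : ℝ≥0∞) ^ k * opt A P.success s =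
        2⁻¹ ^ (k + 1) * opt A P.success s + 2⁻¹ ^ (k + 1) * opt A P.success s := by
      rw [← add_mul, pow_succ, ← mul_add, ENNReal.inv_two_add_inv_two, mul_one]
    rw [hsplit, ← add_assoc] at key
    refine (ENNReal.add_le_add_iff_right (a := 2⁻¹ ^ (k + 1) * opt A P.success s) ?_).mp
      ((add_le_add_right hhalf _).trans key)
    exact ENNReal.mul_ne_top (by simp) hfin

theorem opt_le_progressProb {s : S} (hs : J s) :
    opt A P.success s ≤ progressProb P A (s, (0, 0)) := by
  have h1 : Filter.Tendsto (fun k : ℕ => progressProb P A (s, (0, 0)) + 2⁻¹ ^ k)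
      Filter.atTop (nhds (progressProb P A (s, (0, 0)) + 0)) :=
    (ENNReal.tendsto_pow_atTop_nhds_zero_of_lt_one (by simp)).const_add _
  rw [add_zero] at h1
  refine ge_of_tendsto' h1 fun k => (opt_le_add_half_pow hA hJ k 0 hs).trans ?_
  exact add_le_add_right (mul_le_of_le_one_right' (opt_le_one s)) _

end Attain

-- Comparison of the results of matching states

section Main

variable {S : Type u} {Act : Type v} {P : PLTS S Act}

theorem exists_result_ge (hfin : ∀ s μ, P.trans s P.tau μ → μ.support.Finite)
    {A : S → PMF S → Prop} (hA : ∀ s μ, A s μ → P.trans s P.tau μ) (s : S) (c : ℕ × ℝ≥0∞) :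
    ∃ q ∈ P.Results (SubDist.point s), progressProb P A (s, c) ≤ q := by
  obtain ⟨q, hq, h⟩ := exists_extreme_of_policy (P := P)
    (mv := fun x => (progressPolicy P A x).1) (nx := fun x => (progressPolicy P A x).2)
    (fun x hx => ⟨progressPolicy_trans hA hx, hfin _ _ (progressPolicy_trans hA hx)⟩) (s, c)
  exact ⟨q, hq, iSup_le h⟩

theorem flow_of_lift {trans : S → PMF S → Prop} {Δ Θ : SubDist S}
    (h : Lift (fun s Θ => ∃ μ, trans s μ ∧ Θ = SubDist.ofPMF μ) Δ Θ) :
    Nonempty (Flow trans Δ Θ) := by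
  induction h with
  | base h =>
    obtain ⟨μ, hμ, rfl⟩ := h
    exact ⟨Flow.single hμ⟩
  | @comb n p Δs Θs Δ Θ hp h hΔ hΘ ih =>
    let F := fun i => (ih i).some
    refine ⟨Flow.comb (κ := ULift (Fin n)) (fun i => p i.down) (fun i => F i.down) ?_ ?_⟩
    · intro s
      rw [hΔ, tsum_fintype, ← Equiv.ulift.{u}.symm.sum_comp]
      rfl
    · intro s
      rw [hΘ, tsum_fintype, ← Equiv.ulift.{u}.symm.sum_comp]
      rfl

theorem deriv_of_hyper {Δ Δ' : SubDist S} (h : P.Hyper Δ Δ') :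
    ∃ d : Deriv (fun s => P.trans s P.tau) Δ Δ', ∀ k s, d.go k s ≠ 0 → ¬ P.success s := by
  obtain ⟨go, halt, h1, h2, h3, h4⟩ := h
  have h2' : ∀ k, Nonempty (Flow (fun s => P.trans s P.tau) (go k)
      fun s => go (k + 1) s + halt (k + 1) s) := by
    intro k
    obtain ⟨Θ, hΘ, he⟩ := h2 k
    have := flow_of_lift hΘ
    rwa [show (Θ : S → ℝ≥0∞) = fun s => go (k + 1) s + halt (k + 1) s from funext he] at this
  let F := fun k => (h2' k).some
  exact ⟨⟨fun k => go k, fun k => halt k, h1, F, h4⟩, h3⟩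

/-- Matching states on the right have at least as good results. -/
theorem Matching.hoareLE (hfin : ∀ s μ, P.trans s P.tau μ → μ.support.Finite)
    {R : S → S → Prop} (hR : Matching (fun s => P.trans s P.tau) P.success R) {x s : S}
    (h : R x s) : HoareLE (P.Results (SubDist.point x)) (P.Results (SubDist.point s)) := by
  rintro q ⟨Δ, ⟨hH, -⟩, rfl⟩
  obtain ⟨d, hgo⟩ := deriv_of_hyper hH
  have hval : P.value Δ = expect Δ (ind P.success) := by
    refine tsum_congr fun s => ?_
    by_cases hs : P.success s <;> simp [ind, hs]
  rw [hval]
  -- A value strictly below the optimum is below `optN n` for some `n`, hence a feasible aim of a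
  -- finite-horizon policy. If it equals the optimum, the optimum itself must be attained, by a
  -- policy confined to conserving transitions.
  rcases (hR.expect_ind_le d hgo h).lt_or_eq with hlt | heq
  · obtain ⟨n, hn⟩ := lt_iSup_iff.mp hlt
    obtain ⟨q, hq, hle⟩ := exists_result_ge hfin (fun _ _ h => h) s (n, expect Δ (ind P.success))
    exact ⟨q, hq, (le_progressProb (fun _ _ h => h) (Or.inl hn)).trans hle⟩
  · obtain ⟨J, hJs, hJ⟩ := hR.exists_conserving d hgo h heq.ge
    have hA : ∀ s μ, Conserving (fun s => P.trans s P.tau) P.success J s μ →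
      P.trans s P.tau μ := fun _ _ h => h.1
    obtain ⟨q, hq, hle⟩ := exists_result_ge hfin hA s (0, 0)
    refine ⟨q, hq, heq.le.trans ((hJ s hJs).trans ((opt_le_progressProb hA ?_ hJs).trans hle))⟩
    intro s μ hs hμ
    -- Conserving transitions preserve the full optimum. On `J` it agrees with the restricted one,
    -- so they preserve that as well.
    refine ⟨hμ.2.2, (opt_conserving_le J s).trans (hμ.2.1.trans (expect_mono fun t ht => ?_))⟩
    exact hJ t (hμ.2.2 t ht)

end Main

variable {L : Names.{u}} {D : Definitions L}

/-! ### Finiteness of the supports -/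

theorem finite_support_mix {S : Type*} (r : unitInterval) {μ ν : PMF S} (hμ : μ.support.Finite)
    (hν : ν.support.Finite) : (mix r μ ν).support.Finite := by
  refine (hμ.union hν).subset fun s hs => ?_
  by_contra h
  simp only [Set.mem_union, PMF.mem_support_iff, not_or, not_not] at h
  refine hs ?_
  change ENNReal.ofReal r * μ s + ENNReal.ofReal (1 - r) * ν s = 0
  simp [h.1, h.2]

theorem Proc.finite_support_interp : {n : ℕ} → (p : Proc L n) → p.interp.support.Finite
  | _, .state s => by
    rw [Proc.interp, PMF.support_pure]
    exact Set.finite_singleton s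
  | _, .choice r p q => by
    rw [Proc.interp]
    exact finite_support_mix r p.finite_support_interp q.finite_support_interp

theorem SStep.finite_support {s : State L 0} {a : SAct L} {Δ : PMF (State L 0)}
    (h : SStep D s a Δ) : Δ.support.Finite := by
  induction h <;> first | exact Proc.finite_support_interp _ | assumption

theorem finite_support_locD {Δ : PMF (State L 0)} (h : Δ.support.Finite) (n : L.Node) :
    (locD Δ n).support.Finite := by
  rw [locD, PMF.support_map]
  exact h.image _

theorem mem_support_parD {Δ Θ : PMF (Sys L)} {K : Sys L} :
    K ∈ (parD Δ Θ).support ↔ ∃ M ∈ Δ.support, ∃ N ∈ Θ.support, Sys.par M N = K := by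
  simp [parD, PMF.support_bind, PMF.support_map]

theorem finite_support_parD {Δ Θ : PMF (Sys L)} (hΔ : Δ.support.Finite) (hΘ : Θ.support.Finite) :
    (parD Δ Θ).support.Finite := by
  refine (Set.Finite.image2 Sys.par hΔ hΘ).subset fun K hK => ?_
  obtain ⟨M, hM, N, hN, rfl⟩ := mem_support_parD.mp hK
  exact ⟨M, hM, N, hN, rfl⟩

theorem finite_support_pure {S : Type*} (s : S) : (PMF.pure s).support.Finite := by
  rw [PMF.support_pure]
  exact Set.finite_singleton s

theorem parD_pure_pure (M N : Sys L) :
    parD (PMF.pure M) (PMF.pure N) = PMF.pure (.par M N) := by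
  simp [parD, PMF.pure_map]

theorem IStep.finite_support {Γ : Graph L} {M : Sys L} {a : IAct L} {Δ : PMF (Sys L)}
    (h : IStep D Γ M a Δ) : Δ.support.Finite := by
  induction h with
  | broad n h => exact finite_support_locD h.finite_support n
  | recv h _ => exact finite_support_locD h.finite_support _
  | deaf => exact finite_support_pure _
  | disc => exact finite_support_pure _
  | nil => exact finite_support_pure _
  | tau n h => exact finite_support_locD h.finite_support n
  | tauPropL N _ ih => exact finite_support_parD ih (finite_support_pure _)
  | tauPropR N _ ih => exact finite_support_parD (finite_support_pure _) ih
  | prop _ _ ih₁ ih₂ => exact finite_support_parD ih₁ ih₂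
  | syncL _ _ ih₁ ih₂ => exact finite_support_parD ih₁ ih₂
  | syncR _ _ ih₁ ih₂ => exact finite_support_parD ih₁ ih₂

/-! ### Node names and connectivity -/

theorem nodeList_of_mem_locD {Δ : PMF (State L 0)} {n : L.Node} {K : Sys L}
    (h : K ∈ (locD Δ n).support) : K.nodeList = [n] := by
  rw [locD, PMF.support_map] at h
  obtain ⟨s, -, rfl⟩ := h
  rfl

theorem nodeList_of_mem_parD {Δ Θ : PMF (Sys L)} {M N K : Sys L}
    (hΔ : ∀ M' ∈ Δ.support, M'.nodeList = M.nodeList)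
    (hΘ : ∀ N' ∈ Θ.support, N'.nodeList = N.nodeList) (h : K ∈ (parD Δ Θ).support) :
    K.nodeList = (Sys.par M N).nodeList := by
  obtain ⟨M', hM, N', hN, rfl⟩ := mem_support_parD.mp h
  rw [Sys.nodeList, Sys.nodeList, hΔ _ hM, hΘ _ hN]

theorem nodeList_of_mem_pure {M K : Sys L} (h : K ∈ (PMF.pure M).support) :
    K.nodeList = M.nodeList := by
  rw [PMF.support_pure] at h
  rw [Set.mem_singleton_iff.mp h]

theorem IStep.nodeList_eq {Γ : Graph L} {M : Sys L} {a : IAct L} {Δ : PMF (Sys L)}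
    (h : IStep D Γ M a Δ) : ∀ K ∈ Δ.support, K.nodeList = M.nodeList := by
  induction h with
  | broad n h => exact fun K hK => nodeList_of_mem_locD hK
  | recv h _ => exact fun K hK => nodeList_of_mem_locD hK
  | deaf => exact fun K hK => nodeList_of_mem_pure hK
  | disc => exact fun K hK => nodeList_of_mem_pure hK
  | nil => exact fun K hK => nodeList_of_mem_pure hK
  | tau n h => exact fun K hK => nodeList_of_mem_locD hK
  | tauPropL N _ ih => exact fun K => nodeList_of_mem_parD ih fun K hK => nodeList_of_mem_pure hK
  | tauPropR N _ ih => exact fun K => nodeList_of_mem_parD (fun K hK => nodeList_of_mem_pure hK) ih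
  | prop _ _ ih₁ ih₂ => exact fun K => nodeList_of_mem_parD ih₁ ih₂
  | syncL _ _ ih₁ ih₂ => exact fun K => nodeList_of_mem_parD ih₁ ih₂
  | syncR _ _ ih₁ ih₂ => exact fun K => nodeList_of_mem_parD ih₁ ih₂

theorem Sys.mem_nodes_par {M N : Sys L} {n : L.Node} :
    n ∈ (Sys.par M N).nodes ↔ n ∈ M.nodes ∨ n ∈ N.nodes := by
  simp [Sys.nodes, Sys.nodeList]

theorem Sys.mem_nodes_loc {s : State L 0} {m n : L.Node} : m ∈ (Sys.loc s n).nodes ↔ m = n := by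
  simp [Sys.nodes, Sys.nodeList]

/-- The node that performs an intensional action, or whose broadcast is received. -/
def IAct.node : IAct L → L.Node
  | .snd m _ _ => m
  | .rcv m _ _ => m
  | .tau m => m

/-- Only the edges from the acting node to the nodes of the system matter for a transition. -/
theorem IStep.congr_graph {Γ Γ' : Graph L} {M : Sys L} {a : IAct L} {Δ : PMF (Sys L)}
    (h : IStep D Γ M a Δ) (hE : ∀ n ∈ M.nodes, Γ.E a.node n ↔ Γ'.E a.node n) :
    IStep D Γ' M a Δ := by
  induction h with
  | broad n h => exact .broad n h
  | recv h he => exact .recv h ((hE _ (Sys.mem_nodes_loc.mpr rfl)).mp he)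
  | deaf m n h => exact .deaf m n h
  | disc s c v he => exact .disc s c v fun h => he ((hE _ (Sys.mem_nodes_loc.mpr rfl)).mpr h)
  | nil m c v => exact .nil m c v
  | tau n h => exact .tau n h
  | tauPropL N _ ih => exact .tauPropL N (ih fun n hn => hE n (Sys.mem_nodes_par.mpr (.inl hn)))
  | tauPropR N _ ih => exact .tauPropR N (ih fun n hn => hE n (Sys.mem_nodes_par.mpr (.inr hn)))
  | prop _ _ ih₁ ih₂ =>
    exact .prop (ih₁ fun n hn => hE n (Sys.mem_nodes_par.mpr (.inl hn)))
      (ih₂ fun n hn => hE n (Sys.mem_nodes_par.mpr (.inr hn)))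
  | syncL _ _ ih₁ ih₂ =>
    exact .syncL (ih₁ fun n hn => hE n (Sys.mem_nodes_par.mpr (.inl hn)))
      (ih₂ fun n hn => hE n (Sys.mem_nodes_par.mpr (.inr hn)))
  | syncR _ _ ih₁ ih₂ =>
    exact .syncR (ih₁ fun n hn => hE n (Sys.mem_nodes_par.mpr (.inl hn)))
      (ih₂ fun n hn => hE n (Sys.mem_nodes_par.mpr (.inr hn)))

/-- Whether an action is not a reception. -/
def IAct.IsActive : IAct L → Prop
  | .rcv _ _ _ => False
  | _ => True

theorem IStep.node_mem {Γ : Graph L} {M : Sys L} {a : IAct L} {Δ : PMF (Sys L)}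
    (h : IStep D Γ M a Δ) (ha : a.IsActive) : a.node ∈ M.nodes := by
  induction h with
  | broad n h => exact Sys.mem_nodes_loc.mpr rfl
  | tau n h => exact Sys.mem_nodes_loc.mpr rfl
  | tauPropL N _ ih => exact Sys.mem_nodes_par.mpr (.inl (ih trivial))
  | tauPropR N _ ih => exact Sys.mem_nodes_par.mpr (.inr (ih trivial))
  | syncL _ _ ih _ => exact Sys.mem_nodes_par.mpr (.inl (ih trivial))
  | syncR _ _ _ ih => exact Sys.mem_nodes_par.mpr (.inr (ih trivial))
  | _ => exact ha.elim

/-! ### Reception of a broadcast by a set of nodes -/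

/-- The system `T` receives `c!v` at the nodes in `η`. -/
inductive React (D : Definitions L) (c : L.Chan) (v : L.Val) (η : Set L.Node) :
    Sys L → PMF (Sys L) → Prop
  | recv {s : State L 0} {Δ : PMF (State L 0)} {n : L.Node} :
      SStep D s (.rcv c v) Δ → n ∈ η → React D c v η (.loc s n) (locD Δ n)
  | deaf {s : State L 0} (n : L.Node) :
      (∀ Δ, ¬ SStep D s (.rcv c v) Δ) → React D c v η (.loc s n) (PMF.pure (.loc s n))
  | disc (s : State L 0) {n : L.Node} :
      n ∉ η → React D c v η (.loc s n) (PMF.pure (.loc s n))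
  | nil : React D c v η .nil (PMF.pure .nil)
  | par {M N : Sys L} {Δ Θ : PMF (Sys L)} :
      React D c v η M Δ → React D c v η N Θ → React D c v η (.par M N) (parD Δ Θ)

section React

variable {c : L.Chan} {v : L.Val} {η η₁ η₂ : Set L.Node} {T : Sys L} {ρ : PMF (Sys L)}

theorem IStep.react {Γ : Graph L} {m : L.Node} (h : IStep D Γ T (.rcv m c v) ρ) :
    React D c v {n | Γ.E m n} T ρ := by
  generalize ha : IAct.rcv m c v = a at h
  induction h with
  | recv h he => cases ha; exact .recv h he
  | deaf m n h => cases ha; exact .deaf n h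
  | disc s c v he => cases ha; exact .disc s he
  | nil => exact .nil
  | prop _ _ ih₁ ih₂ => exact .par (ih₁ ha) (ih₂ ha)
  | _ => cases ha

theorem React.iStep {Γ : Graph L} {m : L.Node} (h : React D c v {n | Γ.E m n} T ρ) :
    IStep D Γ T (.rcv m c v) ρ := by
  induction h with
  | recv h hn => exact .recv h hn
  | deaf n h => exact .deaf m n h
  | disc s hn => exact .disc s c v hn
  | nil => exact .nil m c v
  | par _ _ ih₁ ih₂ => exact .prop ih₁ ih₂

theorem React.congr (h : React D c v η₁ T ρ) (hη : ∀ n ∈ T.nodes, n ∈ η₁ ↔ n ∈ η₂) :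
    React D c v η₂ T ρ := by
  induction h with
  | recv h hn => exact .recv h ((hη _ (Sys.mem_nodes_loc.mpr rfl)).mp hn)
  | deaf n h => exact .deaf n h
  | disc s hn => exact .disc s fun h => hn ((hη _ (Sys.mem_nodes_loc.mpr rfl)).mpr h)
  | nil => exact .nil
  | par _ _ ih₁ ih₂ =>
    exact .par (ih₁ fun n hn => hη n (Sys.mem_nodes_par.mpr (.inl hn)))
      (ih₂ fun n hn => hη n (Sys.mem_nodes_par.mpr (.inr hn)))

theorem React.of_disjoint (T : Sys L) (hη : ∀ n ∈ T.nodes, n ∉ η) :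
    React D c v η T (PMF.pure T) := by
  induction T with
  | loc s n => exact .disc s (hη n (Sys.mem_nodes_loc.mpr rfl))
  | par M N ihM ihN =>
    rw [← parD_pure_pure]
    exact .par (ihM fun n hn => hη n (Sys.mem_nodes_par.mpr (.inl hn)))
      (ihN fun n hn => hη n (Sys.mem_nodes_par.mpr (.inr hn)))
  | nil => exact .nil

theorem React.eq_pure (h : React D c v η T ρ) (hη : ∀ n ∈ T.nodes, n ∉ η) : ρ = PMF.pure T := by
  induction h with
  | recv h hn => exact absurd hn (hη _ (Sys.mem_nodes_loc.mpr rfl))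
  | deaf n h => rfl
  | disc s hn => rfl
  | nil => rfl
  | par _ _ ih₁ ih₂ =>
    rw [ih₁ fun n hn => hη n (Sys.mem_nodes_par.mpr (.inl hn)),
      ih₂ fun n hn => hη n (Sys.mem_nodes_par.mpr (.inr hn)), parD_pure_pure]

theorem React.nodeList_eq (h : React D c v η T ρ) : ∀ K ∈ ρ.support, K.nodeList = T.nodeList := by
  induction h with
  | recv h hn => exact fun K hK => nodeList_of_mem_locD hK
  | deaf n h => exact fun K hK => nodeList_of_mem_pure hK
  | disc s hn => exact fun K hK => nodeList_of_mem_pure hK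
  | nil => exact fun K hK => nodeList_of_mem_pure hK
  | par _ _ ih₁ ih₂ => exact fun K => nodeList_of_mem_parD ih₁ ih₂

/-- The componentwise action of two kernels on a parallel composition. -/
def parKernel (κ₁ κ₂ : Sys L → PMF (Sys L)) : Sys L → PMF (Sys L)
  | .par M N => parD (κ₁ M) (κ₂ N)
  | K => PMF.pure K

theorem parD_bind_parKernel (Δ Θ : PMF (Sys L)) (κ₁ κ₂ : Sys L → PMF (Sys L)) :
    (parD Δ Θ).bind (parKernel κ₁ κ₂) = parD (Δ.bind κ₁) (Θ.bind κ₂) := by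
  simp only [parD, PMF.map, PMF.bind_bind, Function.comp_def, PMF.pure_bind, parKernel]
  congr 1
  funext M
  rw [PMF.bind_comm]

/-- A reception at a disjoint union can be performed in two steps. -/
theorem React.split (hη : η₁ ∩ η₂ = ∅) (h : React D c v (η₁ ∪ η₂) T ρ) :
    ∃ (ρ₁ : PMF (Sys L)) (κ : Sys L → PMF (Sys L)), React D c v η₁ T ρ₁ ∧
      (∀ K ∈ ρ₁.support, React D c v η₂ K (κ K)) ∧ ρ = ρ₁.bind κ := by
  induction h with
  | @recv s Δ n h hn =>
    -- A node in `η₁` receives in the first step, and its continuation must then ignore the second.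
    -- Disjointness guarantees this, even if that continuation is again ready to receive.
    by_cases h₁ : n ∈ η₁
    · have h₂ : n ∉ η₂ := fun h₂ => (Set.eq_empty_iff_forall_notMem.mp hη n) ⟨h₁, h₂⟩
      refine ⟨locD Δ n, PMF.pure, .recv h h₁, fun K hK => ?_, (PMF.bind_pure _).symm⟩
      rw [locD, PMF.support_map] at hK
      obtain ⟨s', -, rfl⟩ := hK
      exact .disc s' h₂
    · refine ⟨PMF.pure (.loc s n), fun _ => locD Δ n, .disc s h₁, fun K hK => ?_, by simp⟩
      rw [PMF.support_pure] at hK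
      rw [Set.mem_singleton_iff.mp hK]
      exact .recv h (hn.resolve_left h₁)
  | @deaf s n h =>
    refine ⟨_, PMF.pure, .deaf n h, fun K hK => ?_, (PMF.bind_pure _).symm⟩
    rw [PMF.support_pure] at hK
    rw [Set.mem_singleton_iff.mp hK]
    exact .deaf n h
  | @disc s n hn =>
    refine ⟨_, PMF.pure, .disc s fun h => hn (.inl h), fun K hK => ?_, (PMF.bind_pure _).symm⟩
    rw [PMF.support_pure] at hK
    rw [Set.mem_singleton_iff.mp hK]
    exact .disc s fun h => hn (.inr h)
  | nil =>
    refine ⟨_, PMF.pure, .nil, fun K hK => ?_, (PMF.bind_pure _).symm⟩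
    rw [PMF.support_pure] at hK
    rw [Set.mem_singleton_iff.mp hK]
    exact .nil
  | par _ _ ih₁ ih₂ =>
    obtain ⟨ρ₁, κ₁, h₁, k₁, rfl⟩ := ih₁
    obtain ⟨ρ₂, κ₂, h₂, k₂, rfl⟩ := ih₂
    refine ⟨parD ρ₁ ρ₂, parKernel κ₁ κ₂, .par h₁ h₂, fun K hK => ?_,
      (parD_bind_parKernel _ _ _ _).symm⟩
    obtain ⟨M, hM, N, hN, rfl⟩ := mem_support_parD.mp hK
    exact .par (k₁ M hM) (k₂ N hN)

end React

/-! ### Success of a parallel composition -/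

/-- The test `ω` is enabled in a state. -/
inductive HasTest (D : Definitions L) : State L 0 → Prop
  | test : HasTest D .test
  | sumL {s t : State L 0} : HasTest D s → HasTest D (.sum s t)
  | sumR {s t : State L 0} : HasTest D t → HasTest D (.sum s t)
  | thenB {b : BExpr L 0} {s t : State L 0} :
      evalClosed b = true → HasTest D s → HasTest D (.branch b s t)
  | elseB {b : BExpr L 0} {s t : State L 0} :
      evalClosed b = false → HasTest D t → HasTest D (.branch b s t)
  | call {A : L.Ident} {e : Fin (L.arity A) → Expr L 0} :
      HasTest D ((D A).subst e) → HasTest D (.call A e)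

theorem hasTest_sum {s t : State L 0} : HasTest D (.sum s t) ↔ HasTest D s ∨ HasTest D t :=
  ⟨fun h => by cases h with | sumL h => exact .inl h | sumR h => exact .inr h,
    fun h => h.elim .sumL .sumR⟩

theorem not_hasTest_nil : ¬ HasTest D .nil := nofun

theorem SCong.hasTest_iff {s t : State L 0} (h : SCong D s t) : HasTest D s ↔ HasTest D t := by
  induction h with
  | refl => rfl
  | symm _ ih => exact ih.symm
  | trans _ _ ih₁ ih₂ => exact ih₁.trans ih₂
  | sum _ _ ih₁ ih₂ => rw [hasTest_sum, hasTest_sum, ih₁, ih₂]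
  | comm s t => rw [hasTest_sum, hasTest_sum, or_comm]
  | assoc s t r => simp only [hasTest_sum, or_assoc]
  | unit s => simp [hasTest_sum, not_hasTest_nil]
  | thenB s t hb =>
    refine ⟨fun h => ?_, .thenB hb⟩
    cases h with
    | thenB _ h => exact h
    | elseB hb' => simp [hb] at hb'
  | elseB s t hb =>
    refine ⟨fun h => ?_, .elseB hb⟩
    cases h with
    | thenB hb' => simp [hb] at hb'
    | elseB _ h => exact h
  | call A e =>
    refine ⟨fun h => ?_, .call⟩
    cases h with
    | call h => exact h

theorem HasTest.exists_sCong {s : State L 0} (h : HasTest D s) :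
    ∃ s', SCong D s (.sum .test s') := by
  induction h with
  | test => exact ⟨.nil, .symm (.unit _)⟩
  | sumL _ ih =>
    obtain ⟨s', h⟩ := ih
    exact ⟨_, .trans (.sum h (.refl _)) (.assoc _ _ _)⟩
  | sumR _ ih =>
    obtain ⟨s', h⟩ := ih
    exact ⟨_, .trans (.comm _ _) (.trans (.sum h (.refl _)) (.assoc _ _ _))⟩
  | thenB hb _ ih =>
    obtain ⟨s', h⟩ := ih
    exact ⟨s', .trans (.thenB _ _ hb) h⟩
  | elseB hb _ ih =>
    obtain ⟨s', h⟩ := ih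
    exact ⟨s', .trans (.elseB _ _ hb) h⟩
  | call _ ih =>
    obtain ⟨s', h⟩ := ih
    exact ⟨s', .trans (.call _ _) h⟩

/-- The test `ω` is enabled at some node of a system term. -/
def Sys.HasTest (D : Definitions L) : Sys L → Prop
  | .loc s _ => WNet.HasTest D s
  | .par M N => M.HasTest D ∨ N.HasTest D
  | .nil => False

theorem Cong.hasTest_iff {M N : Sys L} (h : Cong D M N) : M.HasTest D ↔ N.HasTest D := by
  induction h with
  | refl => rfl
  | symm _ ih => exact ih.symm
  | trans _ _ ih₁ ih₂ => exact ih₁.trans ih₂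
  | par _ _ ih₁ ih₂ => exact or_congr ih₁ ih₂
  | comm M N => exact or_comm
  | assoc M N K => exact or_assoc
  | unit M => exact iff_of_eq (or_false _)
  | loc n h => exact h.hasTest_iff

/-- Success is defined through an arbitrary congruence. The syntactic predicate is invariant under
congruence and produces the required normal form, so success can be decided componentwise in a
parallel composition. -/
theorem successful_iff {M : Sys L} : Successful D M ↔ M.HasTest D := by
  constructor
  · rintro ⟨M', s, n, h⟩
    exact h.hasTest_iff.mpr (.inr (.sumL .test))
  · intro h
    induction M with
    | loc s n =>
      obtain ⟨s', hs⟩ := HasTest.exists_sCong h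
      exact ⟨.nil, s', n, .trans (.loc n hs) (.trans (.symm (.unit _)) (.comm _ _))⟩
    | par M N ihM ihN =>
      rcases h with h | h
      · obtain ⟨M', s, n, hc⟩ := ihM h
        exact ⟨.par N M', s, n, .trans (.comm _ _)
          (.trans (.par (.refl _) hc) (.symm (.assoc _ _ _)))⟩
      · obtain ⟨N', s, n, hc⟩ := ihN h
        exact ⟨.par M N', s, n, .trans (.par (.refl _) hc) (.symm (.assoc _ _ _))⟩
    | nil => exact h.elim

theorem successful_par {M N : Sys L} :
    Successful D (.par M N) ↔ Successful D M ∨ Successful D N := by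
  simp only [successful_iff]
  rfl

/-! ### Transitions of composed networks -/

/-- The conditions under which the network `N` is run with the test `T`. -/
structure Fits (N T : Net L) : Prop where
  left : N.WellFormed
  right : T.WellFormed
  composable : N.Composable T

/-- Two networks with the same graph and the same node names. -/
def SameShape (M N : Net L) : Prop := N.graph = M.graph ∧ N.sys.nodeList = M.sys.nodeList

theorem SameShape.trans {M N K : Net L} (h₁ : SameShape M N) (h₂ : SameShape N K) :
    SameShape M K := ⟨h₂.1.trans h₁.1, h₂.2.trans h₁.2⟩

theorem SameShape.nodes_eq {M N : Net L} (h : SameShape M N) : N.sys.nodes = M.sys.nodes := by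
  rw [Sys.nodes, Sys.nodes, h.2]

theorem SameShape.wellFormed {M N : Net L} (h : SameShape M N) (hM : M.WellFormed) :
    N.WellFormed := by
  refine ⟨⟨?_, ?_⟩, ?_, ?_⟩
  · rw [h.2]
    exact hM.isNetwork.1
  · rw [h.nodes_eq, h.1]
    exact hM.isNetwork.2
  · rw [h.nodes_eq, h.1]
    exact hM.edge
  · rw [h.nodes_eq, h.1]
    exact hM.isolated

theorem Fits.congr_left {M N T : Net L} (h : SameShape M N) (hM : Fits M T) : Fits N T :=
  ⟨h.wellFormed hM.left, hM.right, by
    have := hM.composable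
    rwa [Net.Composable, ← h.nodes_eq] at this⟩

theorem Fits.congr_right {M T : Net L} {t : Sys L} (h : t.nodeList = T.sys.nodeList)
    (hM : Fits M T) : Fits M ⟨T.graph, t⟩ :=
  ⟨hM.left, SameShape.wellFormed (M := T) ⟨rfl, h⟩ hM.right, hM.composable⟩

theorem EStep.sameShape {N : Net L} {a : EAct L} {μ : PMF (Net L)} (h : EStep D N a μ)
    {K : Net L} (hK : μ K ≠ 0) : SameShape N K := by
  have key : ∀ {Δ : PMF (Sys L)} {a}, IStep D N.graph N.sys a Δ → netD N.graph Δ K ≠ 0 →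
      SameShape N K := by
    intro Δ a h hK
    rw [← PMF.mem_support_iff, netD, PMF.support_map] at hK
    obtain ⟨M, hM, rfl⟩ := hK
    exact ⟨rfl, h.nodeList_eq M hM⟩
  cases h with
  | tau _ h => exact key h hK
  | tauBroad _ h => exact key h hK
  | inp _ h => exact key h hK
  | out _ h => exact key h hK

/-- The weights of the compositions of networks weighted by `m` with systems weighted by `r`. -/
def compose (Γ : Graph L) (m : Net L → ℝ≥0∞) (r : Sys L → ℝ≥0∞) (K : Net L) : ℝ≥0∞ :=
  expect m fun N => expect r fun t => PMF.pure (N.comp ⟨Γ, t⟩) K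

section Compose

variable {Γ : Graph L}

theorem compose_pure_left (N : Net L) (r : Sys L → ℝ≥0∞) (K : Net L) :
    compose Γ (PMF.pure N) r K = expect r fun t => PMF.pure (N.comp ⟨Γ, t⟩) K :=
  expect_pure _ _

theorem compose_pure_pure (N : Net L) (t : Sys L) :
    compose Γ (PMF.pure N) (PMF.pure t) = PMF.pure (N.comp ⟨Γ, t⟩) := by
  funext K
  rw [compose_pure_left, expect_pure]

theorem compose_combination_left {ι : Type*} {m : Net L → ℝ≥0∞} {p : ι → ℝ≥0∞}
    {M : ι → Net L → ℝ≥0∞} (hm : ∀ N, m N = ∑' i, p i * M i N) (r : Sys L → ℝ≥0∞) (K : Net L) :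
    compose Γ m r K = ∑' i, p i * compose Γ (M i) r K :=
  expect_combination hm

theorem compose_combination_right {ι : Type*} {r : Sys L → ℝ≥0∞} {p : ι → ℝ≥0∞}
    {ρ : ι → Sys L → ℝ≥0∞} (hr : ∀ t, r t = ∑' i, p i * ρ i t) (m : Net L → ℝ≥0∞) (K : Net L) :
    compose Γ m r K = ∑' i, p i * compose Γ m (ρ i) K := by
  unfold compose
  simp_rw [expect_combination hr]
  exact expect_combination_right _ _ _

theorem compose_netD (Γ' : Graph L) (Δ ρ : PMF (Sys L)) (K : Net L) :
    netD (Γ'.union Γ) (parD Δ ρ) K = compose Γ (netD Γ' Δ) ρ K := by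
  rw [compose, netD, netD, expect_map, parD, PMF.map_bind, PMF.bind_apply]
  refine tsum_congr fun M => ?_
  rw [PMF.map_comp, PMF.map, PMF.bind_apply]
  rfl

theorem netD_pure (N : Net L) : netD N.graph (PMF.pure N.sys) = PMF.pure N := by
  rw [netD, PMF.pure_map]

end Compose

theorem exists_red_comp {N : Net L} {Γ : Graph L} {t : Sys L} {Δ ρ : PMF (Sys L)}
    (h : (∃ m, IStep D (N.graph.union Γ) (.par N.sys t) (.tau m) (parD Δ ρ)) ∨
      ∃ m c v, IStep D (N.graph.union Γ) (.par N.sys t) (.snd m c v) (parD Δ ρ)) :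
    ∃ ν, Red D (N.comp ⟨Γ, t⟩) ν ∧ ∀ K, ν K = compose Γ (netD N.graph Δ) ρ K :=
  ⟨_, ⟨_, rfl, h⟩, fun K => compose_netD _ _ _ K⟩

section Moves

variable {N : Net L} {Γ : Graph L} {t : Sys L} (hF : Fits N ⟨Γ, t⟩)
include hF

theorem Fits.not_edge_left {m n : L.Node} (hm : m ∈ N.sys.nodes) : ¬ Γ.E m n := fun h =>
  Set.eq_empty_iff_forall_notMem.mp hF.composable m ⟨hm, Γ.left_mem m n h⟩

theorem Fits.not_edge_right {m n : L.Node} (hn : n ∈ N.sys.nodes) : ¬ Γ.E m n := fun h =>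
  Set.eq_empty_iff_forall_notMem.mp hF.composable n ⟨hn, Γ.right_mem m n h⟩

theorem Fits.notMem_of_mem {n : L.Node} (hn : n ∈ t.nodes) : n ∉ N.sys.nodes := fun h =>
  Set.eq_empty_iff_forall_notMem.mp hF.composable n ⟨h, hF.right.isNetwork.2 hn⟩

/-- No node of `N` occurs in the graph of the test, so the test adds no edge that ends in a node of
`N`. -/
theorem Fits.iStep_left_iff {a : IAct L} {Δ : PMF (Sys L)} :
    IStep D (N.graph.union Γ) N.sys a Δ ↔ IStep D N.graph N.sys a Δ := by
  have : ∀ n ∈ N.sys.nodes, (N.graph.union Γ).E a.node n ↔ N.graph.E a.node n := fun n hn =>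
    or_iff_left (hF.not_edge_right hn)
  exact ⟨fun h => h.congr_graph this, fun h => h.congr_graph fun n hn => (this n hn).symm⟩

/-- By well-formedness every edge of `N` has an endpoint in `N`, so `N` adds no edge between two
nodes of the test. -/
theorem Fits.iStep_right_iff {a : IAct L} (ha : a.node ∈ t.nodes) {ρ : PMF (Sys L)} :
    IStep D (N.graph.union Γ) t a ρ ↔ IStep D Γ t a ρ := by
  have : ∀ n ∈ t.nodes, (N.graph.union Γ).E a.node n ↔ Γ.E a.node n := fun n hn => by
    refine or_iff_right fun h => ?_
    exact (hF.left.edge _ _ (.inl h)).elim (hF.notMem_of_mem ha) (hF.notMem_of_mem hn)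
  exact ⟨fun h => h.congr_graph this, fun h => h.congr_graph fun n hn => (this n hn).symm⟩

theorem Fits.mem_outp_of_edge {m n : L.Node} (hn : n ∈ t.nodes) (h : N.graph.E m n) :
    n ∈ N.outp :=
  ⟨⟨N.graph.right_mem m n h, hF.notMem_of_mem hn⟩, m, h⟩

/-- What the test observes of a broadcast by `N` depends only on the target set of the extensional
output, not on the broadcasting node. An answer from a different node of another network therefore
has the same effect. -/
theorem Fits.iStep_rcv_iff {m : L.Node} (hm : m ∈ N.sys.nodes) {c : L.Chan} {v : L.Val}
    {ρ : PMF (Sys L)} : IStep D (N.graph.union Γ) t (.rcv m c v) ρ ↔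
      React D c v {o ∈ N.outp | N.graph.E m o} t ρ := by
  have key : ∀ n ∈ t.nodes,
      (n ∈ {n | (N.graph.union Γ).E m n} ↔ n ∈ {o ∈ N.outp | N.graph.E m o}) := fun n hn =>
    ⟨fun h => by
      have h' : N.graph.E m n := h.resolve_right (hF.not_edge_left hm)
      exact ⟨hF.mem_outp_of_edge hn h', h'⟩, fun h => .inl h.2⟩
  exact ⟨fun h => h.react.congr key, fun h => (h.congr fun n hn => (key n hn).symm).iStep⟩

theorem Fits.red_of_tau {μ : PMF (Net L)} (h : EStep D N .tau μ) :
    ∃ ν, Red D (N.comp ⟨Γ, t⟩) ν ∧ ∀ K, ν K = compose Γ μ (PMF.pure t) K := by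
  cases h with
  | tau _ h => exact exists_red_comp (.inl ⟨_, .tauPropL t (hF.iStep_left_iff.mpr h)⟩)
  | @tauBroad n c v Δ _ h hE =>
    refine exists_red_comp (.inr ⟨n, c, v, .syncL (hF.iStep_left_iff.mpr h) ?_⟩)
    -- A broadcast that counts as internal has no out-neighbours outside `N`, so the test is left
    -- unchanged.
    refine (hF.iStep_rcv_iff (h.node_mem trivial)).mpr (React.of_disjoint t fun o _ ho => ?_)
    exact ho.1.1.2 (hE o ho.2)

theorem Fits.red_of_out {c : L.Chan} {v : L.Val} {η : Set L.Node} {μ : PMF (Net L)}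
    (h : EStep D N (.out c v η) μ) {ρ : PMF (Sys L)} (hρ : React D c v η t ρ) :
    ∃ ν, Red D (N.comp ⟨Γ, t⟩) ν ∧ ∀ K, ν K = compose Γ μ ρ K := by
  cases h with
  | out _ h hη _ =>
    subst hη
    exact exists_red_comp (.inr ⟨_, _, _, .syncL (hF.iStep_left_iff.mpr h)
      ((hF.iStep_rcv_iff (h.node_mem trivial)).mpr hρ)⟩)

theorem Fits.red_of_inp {n : L.Node} {c : L.Chan} {v : L.Val} {μ : PMF (Net L)}
    (h : EStep D N (.inp n c v) μ) {ρ : PMF (Sys L)} (hρ : IStep D Γ t (.snd n c v) ρ) :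
    ∃ ν, Red D (N.comp ⟨Γ, t⟩) ν ∧ ∀ K, ν K = compose Γ μ ρ K := by
  cases h with
  | inp _ h _ =>
    exact exists_red_comp (.inr ⟨_, _, _, .syncR (hF.iStep_left_iff.mpr h)
      ((hF.iStep_right_iff (hρ.node_mem trivial)).mpr hρ)⟩)

/-- A test node that has an edge into `N` is an input node of `N`; without such edges all of `N` is
disconnected from the broadcast. -/
theorem Fits.eq_pure_of_notMem_inp {n : L.Node} (hn : n ∈ t.nodes) (hinp : n ∉ N.inp)
    {c : L.Chan} {v : L.Val} {Δ : PMF (Sys L)} :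
    IStep D N.graph N.sys (.rcv n c v) Δ ↔ Δ = PMF.pure N.sys := by
  have : ∀ m ∈ N.sys.nodes, m ∉ {m | N.graph.E n m} := fun m _ h =>
    hinp ⟨⟨N.graph.left_mem n m h, hF.notMem_of_mem hn⟩, m, h⟩
  exact ⟨fun h => h.react.eq_pure this, fun h => h ▸ (React.of_disjoint _ this).iStep⟩

end Moves

/-! ### Weak moves in a context -/

section Context

variable {Γ : Graph L} {t : Sys L}

theorem Flow.exists_compose {B : Net L → PMF (Net L) → Prop} {m m' : Net L → ℝ≥0∞}
    (F : Flow B m m') {ρ : PMF (Sys L)}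
    (h : ∀ N μ, m N ≠ 0 → B N μ →
      ∃ ν, Red D (N.comp ⟨Γ, t⟩) ν ∧ ∀ K, ν K = compose Γ μ ρ K) :
    Nonempty (Flow (Red D) (compose Γ m (PMF.pure t)) (compose Γ m' ρ)) := by
  have h' : ∀ i, ∃ ν : PMF (Net L), F.weight i ≠ 0 →
      Red D ((F.src i).comp ⟨Γ, t⟩) ν ∧ ∀ K, ν K = compose Γ (F.tgt i) ρ K := by
    intro i
    by_cases hi : F.weight i = 0
    · exact ⟨PMF.pure (F.src i), fun h => absurd hi h⟩
    · obtain ⟨ν, hν⟩ := h _ _ (F.src_ne_zero hi) (F.trans i hi)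
      exact ⟨ν, fun _ => hν⟩
  choose ν hν using h'
  refine ⟨⟨F.ι, F.weight, fun i => (F.src i).comp ⟨Γ, t⟩, ν, fun i hi => (hν i hi).1, ?_, ?_⟩⟩
  · intro K
    rw [compose_combination_left F.left]
    simp_rw [compose_pure_pure]
  · intro K
    rw [compose_combination_left F.right]
    refine tsum_congr fun i => ?_
    by_cases hi : F.weight i = 0
    · simp [hi]
    · rw [(hν i hi).2]

theorem sameShape_of_step {N₀ : Net L} {a : EAct L} {m m' : Net L → ℝ≥0∞}
    (F : Flow (fun N => EStep D N a) m m') (h : ∀ N, m N ≠ 0 → SameShape N₀ N) {N : Net L}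
    (hN : m' N ≠ 0) : SameShape N₀ N := by
  obtain ⟨i, hi, hiN⟩ := F.exists_of_ne_zero hN
  exact (h _ (F.src_ne_zero hi)).trans ((F.trans i hi).sameShape hiN)

theorem sameShape_of_stage {N₀ : Net L} {m m' : Net L → ℝ≥0∞}
    (d : Deriv (fun N => EStep D N .tau) m m') (h : ∀ N, m N ≠ 0 → SameShape N₀ N) (k : ℕ)
    {N : Net L} (hN : d.stage k N ≠ 0) : SameShape N₀ N := by
  induction k generalizing N with
  | zero =>
    rw [d.stage_zero] at hN
    exact h N hN
  | succ k ih =>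
    exact sameShape_of_step (d.flow k) (fun N hN => ih (d.stage_ne_zero_of_go hN)) hN

theorem sameShape_of_deriv {N₀ : Net L} {m m' : Net L → ℝ≥0∞}
    (d : Deriv (fun N => EStep D N .tau) m m') (h : ∀ N, m N ≠ 0 → SameShape N₀ N) {N : Net L}
    (hN : m' N ≠ 0) : SameShape N₀ N := by
  rw [d.result] at hN
  by_contra hn
  refine hN (ENNReal.tsum_eq_zero.mpr fun k => ?_)
  by_contra hk
  exact hn (sameShape_of_stage d h k (d.stage_ne_zero_of_halt hk))

theorem compose_point_pure (N : Net L) : compose Γ (SubDist.point N) (PMF.pure t) =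
    PMF.pure (N.comp ⟨Γ, t⟩) := compose_pure_pure N t

/-- The distributions that arise from networks with the shape of `N₀`. -/
def Shaped (N₀ : Net L) (m : Net L → ℝ≥0∞) : Prop := ∀ N, m N ≠ 0 → SameShape N₀ N

theorem shaped_point (N : Net L) : Shaped N (SubDist.point N) := by
  intro K hK
  have : K = N := by simpa [SubDist.point, SubDist.ofPMF] using hK
  rw [this]
  exact ⟨rfl, rfl⟩

theorem Shaped.fits {N₀ : Net L} {m : Net L → ℝ≥0∞} (h : Shaped N₀ m) {T : Net L}
    (hF : Fits N₀ T) {N : Net L} (hN : m N ≠ 0) : Fits N T := hF.congr_left (h N hN)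

theorem Shaped.hyper {N₀ : Net L} {Δ Δ' : SubDist (Net L)} (h : Shaped N₀ Δ)
    (hH : (extensional D).Hyper Δ Δ') : Shaped N₀ Δ' := by
  obtain ⟨d, -⟩ := deriv_of_hyper hH
  exact fun N hN => sameShape_of_deriv d h hN

theorem Shaped.step {N₀ : Net L} {a : EAct L} {Δ Δ' : SubDist (Net L)} (h : Shaped N₀ Δ)
    (hS : (extensional D).Step a Δ Δ') : Shaped N₀ Δ' := by
  obtain ⟨F⟩ := flow_of_lift hS
  exact fun N hN => sameShape_of_step F h hN

/-- Once the test is distributed by `ρ`, it may evolve differently from each system in the support;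
the resulting evolutions are combined with the weights of `ρ`. -/
theorem Evolves.compose_kernel {m m' : Net L → ℝ≥0∞} {ρ : PMF (Sys L)} {κ : Sys L → PMF (Sys L)}
    (h : ∀ K ∈ ρ.support, Evolves (Red D) (compose Γ m (PMF.pure K)) (compose Γ m' (κ K))) :
    Evolves (Red D) (compose Γ m ρ) (compose Γ m' (ρ.bind κ)) := by
  refine .comb (κ := Sys L) (fun K => ρ K) (M := fun K => compose Γ m (PMF.pure K))
    (M' := fun K => compose Γ m' (κ K)) h ?_ ?_
  · refine compose_combination_right (fun K => ?_) m
    have := PMF.bind_apply ρ PMF.pure K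
    rwa [PMF.bind_pure] at this
  · exact compose_combination_right (fun K => PMF.bind_apply ρ κ K) m'

theorem Evolves.hyper {N₀ : Net L} (hF : Fits N₀ ⟨Γ, t⟩) {Δ Δ' : SubDist (Net L)}
    (hΔ : Shaped N₀ Δ) (h : (extensional D).Hyper Δ Δ') :
    Evolves (Red D) (compose Γ Δ (PMF.pure t)) (compose Γ Δ' (PMF.pure t)) := by
  -- The information that moving networks are unsuccessful is dropped: it does not carry over to the
  -- compositions, which may be successful through the test.
  obtain ⟨d, -⟩ := deriv_of_hyper h
  have hG : ∀ k, Nonempty (Flow (Red D) (compose Γ (d.go k) (PMF.pure t))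
      (compose Γ (fun N => d.go (k + 1) N + d.halt (k + 1) N) (PMF.pure t))) := fun k =>
    (d.flow k).exists_compose fun N μ hN hμ =>
      (hF.congr_left (sameShape_of_stage d hΔ k (d.stage_ne_zero_of_go hN))).red_of_tau hμ
  refine .deriv
    { go := fun k => compose Γ (d.go k) (PMF.pure t)
      halt := fun k => compose Γ (d.halt k) (PMF.pure t)
      init := fun K => ?_
      flow := fun k => ?_
      result := fun K => ?_ }
  · simp only [compose]
    rw [← expect_add]
    congr
    funext N
    exact d.init N
  · refine cast ?_ (hG k).some
    congr
    funext K
    exact expect_add _ _ _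
  · simp only [compose]
    rw [← expect_tsum]
    congr
    funext N
    exact d.result N

theorem Evolves.hyper_kernel {N₀ : Net L} (hF : Fits N₀ ⟨Γ, t⟩) {Δ Δ' : SubDist (Net L)}
    (hΔ : Shaped N₀ Δ) (h : (extensional D).Hyper Δ Δ') {ρ : PMF (Sys L)}
    (hρ : ∀ K ∈ ρ.support, K.nodeList = t.nodeList) :
    Evolves (Red D) (compose Γ Δ ρ) (compose Γ Δ' ρ) := by
  have := Evolves.compose_kernel (D := D) (Γ := Γ) (m := Δ) (m' := Δ') (ρ := ρ) (κ := PMF.pure)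
    fun K hK => Evolves.hyper (hF.congr_right (hρ K hK)) hΔ h
  rwa [PMF.bind_pure] at this

/-- Internal activity, a strong action to which the context reacts, and internal activity. -/
theorem Evolves.hyper_step_hyper {N₀ : Net L} (hF : Fits N₀ ⟨Γ, t⟩) {a : EAct L}
    {Δ₁ Δ₂ Δ : SubDist (Net L)} (h₁ : (extensional D).Hyper (SubDist.point N₀) Δ₁)
    (h₂ : (extensional D).Step a Δ₁ Δ₂) (h₃ : (extensional D).Hyper Δ₂ Δ) {ρ : PMF (Sys L)}
    (hρ : ∀ K ∈ ρ.support, K.nodeList = t.nodeList)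
    (hred : ∀ N μ, Fits N ⟨Γ, t⟩ → EStep D N a μ →
      ∃ ν, Red D (N.comp ⟨Γ, t⟩) ν ∧ ∀ K, ν K = compose Γ μ ρ K) :
    Evolves (Red D) (PMF.pure (N₀.comp ⟨Γ, t⟩)) (compose Γ Δ ρ) := by
  have hs₁ := (shaped_point N₀).hyper h₁
  obtain ⟨F⟩ := flow_of_lift h₂
  obtain ⟨G⟩ := F.exists_compose (D := D) (Γ := Γ) (t := t) (ρ := ρ) fun N μ hN hμ =>
    hred N μ (hs₁.fits hF hN) hμ
  have e₁ := Evolves.hyper hF (shaped_point N₀) h₁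
  rw [compose_point_pure] at e₁
  exact (e₁.trans (.flow G)).trans (Evolves.hyper_kernel hF (hs₁.step h₂) h₃ hρ)

/-- A move to `Δ` which broadcasts `c!v` to the nodes in `η`, in every context. -/
def OutEvolves (D : Definitions L) (c : L.Chan) (v : L.Val) (η : Set L.Node) (N : Net L)
    (Δ : SubDist (Net L)) : Prop :=
  Shaped N Δ ∧ ∀ (Γ : Graph L) (t : Sys L) (ρ : PMF (Sys L)), Fits N ⟨Γ, t⟩ → React D c v η t ρ →
    Evolves (Red D) (PMF.pure (N.comp ⟨Γ, t⟩)) (compose Γ Δ ρ)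

/-- Carries the effect of an output from states to sub-distributions, by induction on the lifting.
Components of weight zero are unconstrained, so the shape is known, and the evolution needed, only
for those of positive weight. -/
theorem evolves_of_lift {c : L.Chan} {v : L.Val} {η : Set L.Node} {Δ Θ : SubDist (Net L)}
    (h : Lift (OutEvolves D c v η) Δ Θ) (N₀ : Net L) (hΔ : Shaped N₀ Δ) :
    Shaped N₀ Θ ∧ ∀ (Γ : Graph L) (t : Sys L) (ρ : PMF (Sys L)), Fits N₀ ⟨Γ, t⟩ →
      React D c v η t ρ → Evolves (Red D) (compose Γ Δ (PMF.pure t)) (compose Γ Θ ρ) := by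
  induction h with
  | @base N Θ h =>
    have hN : SameShape N₀ N := hΔ N (by simp [SubDist.point, SubDist.ofPMF])
    refine ⟨fun K hK => hN.trans (h.1 K hK), fun Γ t ρ hF hρ => ?_⟩
    rw [compose_point_pure]
    exact h.2 Γ t ρ (hF.congr_left hN) hρ
  | @comb n p Δs Θs Δ Θ _ _ hl hr ih =>
    have hs : ∀ i, p i ≠ 0 → Shaped N₀ (Δs i) := fun i hi N hN => hΔ N (by
      rw [hl]
      exact fun h => mul_ne_zero hi hN (Finset.sum_eq_zero_iff.mp h i (Finset.mem_univ i)))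
    have htsum : ∀ f : Fin n → ℝ≥0∞, ∑ i, f i = ∑' i : ULift.{u} (Fin n), f i.down := fun f => by
      rw [tsum_fintype, ← Equiv.ulift.{u}.symm.sum_comp]
      rfl
    constructor
    · intro N hN
      rw [hr] at hN
      obtain ⟨i, -, hi⟩ := Finset.exists_ne_zero_of_sum_ne_zero hN
      exact (ih i (hs i (left_ne_zero_of_mul hi))).1 N (right_ne_zero_of_mul hi)
    · intro Γ t ρ hF hρ
      refine .comb (κ := ULift.{u} (Fin n)) (fun i => p i.down)
        (fun i hi => (ih i.down (hs i.down hi)).2 Γ t ρ hF hρ) ?_ ?_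
      · exact compose_combination_left (fun N => (hl N).trans (htsum _)) _
      · exact compose_combination_left (fun N => (hr N).trans (htsum _)) _

/-- Since `WeakOut` is the least family with these closure conditions, checking them for
`OutEvolves` is induction on weak outputs. In the composite case the test first reacts to `η₁`, and
each system that it may then have become reacts to `η₂`. -/
theorem weakOutClosed_outEvolves (D : Definitions L) (c : L.Chan) (v : L.Val) :
    WeakOutClosed D c v (OutEvolves D c v) where
  single h₁ h₂ h₃ :=
    ⟨(((shaped_point _).hyper h₁).step h₂).hyper h₃, fun _ _ _ hF hρ =>
      Evolves.hyper_step_hyper hF h₁ h₂ h₃ hρ.nodeList_eq fun _ _ hN hμ => hN.red_of_out hμ hρ⟩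
  multi := by
    intro η₁ η₂ N Δ' Δ h₁ h₂ hη
    obtain ⟨hs, he⟩ := evolves_of_lift h₂ N h₁.1
    refine ⟨hs, fun Γ t ρ hF hρ => ?_⟩
    obtain ⟨ρ₁, κ, hρ₁, hκ, rfl⟩ := hρ.split hη
    refine (h₁.2 Γ t ρ₁ hF hρ₁).trans (Evolves.compose_kernel fun K hK => ?_)
    exact he Γ K _ (hF.congr_right (hρ₁.nodeList_eq K hK)) (hκ K hK)

theorem WeakOut.outEvolves {c : L.Chan} {v : L.Val} {η : Set L.Node} {N : Net L}
    {Δ : SubDist (Net L)} (h : WeakOut D c v η N Δ) : OutEvolves D c v η N Δ :=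
  h _ (weakOutClosed_outEvolves D c v)

end Context

/-! ### Strong actions as weak actions -/

section Strong

variable {S : Type u} {Act : Type v} {P : PLTS S Act}

/-- The zero sub-distribution. -/
def SubDist.zero : SubDist S := ⟨fun _ => 0, by simp⟩

theorem PLTS.step_zero (a : Act) : P.Step a SubDist.zero SubDist.zero :=
  .comb (n := 0) nofun nofun nofun _ _ (by simp) nofun (fun _ => by simp [SubDist.zero])
    fun _ => by simp [SubDist.zero]

theorem PLTS.Hyper.refl (Δ : SubDist S) : P.Hyper Δ Δ := by
  refine ⟨fun _ => SubDist.zero, fun k => if k = 0 then Δ else SubDist.zero, fun s => ?_,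
    fun k => ⟨SubDist.zero, P.step_zero _, fun s => ?_⟩, fun k s h => absurd rfl h, fun s => ?_⟩
  · simp [SubDist.zero]
  · simp [SubDist.zero]
  · rw [tsum_eq_single 0 fun k hk => by simp [hk, SubDist.zero]]
    simp

theorem PLTS.Hyper.of_trans {s : S} (hs : ¬ P.success s) {μ : PMF S} (h : P.trans s P.tau μ) :
    P.Hyper (SubDist.point s) (SubDist.ofPMF μ) := by
  refine ⟨fun k => if k = 0 then SubDist.point s else SubDist.zero,
    fun k => if k = 1 then SubDist.ofPMF μ else SubDist.zero, fun s => ?_, fun k => ?_,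
    fun k t ht => ?_, fun s => ?_⟩
  · simp [SubDist.zero]
  · obtain _ | k := k
    · exact ⟨_, .base ⟨μ, h, rfl⟩, fun s => by simp [SubDist.zero]⟩
    · exact ⟨SubDist.zero, by simpa using P.step_zero _, fun s => by simp [SubDist.zero]⟩
  · by_cases hk : k = 0
    · have : t = s := by simpa [hk, SubDist.point, SubDist.ofPMF] using ht
      rwa [this]
    · simp [hk, SubDist.zero] at ht
  · rw [tsum_eq_single 1 fun k hk => by simp [hk, SubDist.zero]]
    simp

theorem EStep.not_success {M : Net L} {a : EAct L} {μ : PMF (Net L)} (h : EStep D M a μ) :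
    ¬ M.Success D := by
  cases h <;> assumption

theorem EStep.weak {M : Net L} {a : EAct L} {μ : PMF (Net L)} (h : EStep D M a μ) :
    Weak D a M (SubDist.ofPMF μ) := by
  cases a with
  | tau => exact PLTS.Hyper.of_trans (P := extensional D) h.not_success h
  | inp n c v => exact ⟨_, _, .refl _, .base ⟨μ, h, rfl⟩, .refl _⟩
  | out c v η =>
    exact (weakOutClosed_weakOut D c v).single (.refl _) (.base ⟨μ, h, rfl⟩) (.refl _)

end Strong

/-! ### Simulation and testing -/

section Simulation

theorem Sim.wellFormed {M N : Net L} (h : Sim D M N) : M.WellFormed ∧ N.WellFormed := by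
  obtain ⟨R, hR, h⟩ := h
  exact hR.wellFormed h

theorem Sim.inp_eq {M N : Net L} (h : Sim D M N) : M.inp = N.inp := by
  obtain ⟨R, hR, h⟩ := h
  exact hR.inp h

theorem Sim.outp_eq {M N : Net L} (h : Sim D M N) : M.outp = N.outp := by
  obtain ⟨R, hR, h⟩ := h
  exact hR.outp h

/-- The simulation conditions speak of weak actions on both sides; a strong action is a weak one,
with trivial internal activity around it or as a single internal step. The simulation at hand is
contained in `Sim`, to which the lifted relation is enlarged. -/
theorem Sim.exists_weak {M N : Net L} (h : Sim D M N) {a : EAct L} {μ : PMF (Net L)}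
    (hμ : EStep D M a μ) :
    ∃ Θ, Weak D a N Θ ∧ Lift (toPoint (Sim D)) (SubDist.ofPMF μ) Θ := by
  obtain ⟨R, hR, h⟩ := h
  obtain ⟨Θ, -, hw, hl⟩ := hR.step h hμ.not_success a (SubDist.ofPMF μ) μ.tsum_coe hμ.weak
  exact ⟨Θ, hw, hl.mono fun M Θ ⟨N, hN, he⟩ => ⟨N, ⟨R, hR, hN⟩, he⟩⟩

theorem Coupling.nonempty_single {S : Type u} {R : S → S → Prop} {s t : S} (h : R s t) :
    Nonempty (Coupling R (PMF.pure s) (PMF.pure t)) :=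
  ⟨⟨PUnit, fun _ => 1, fun _ => s, fun _ => t, fun _ _ => h, by simp, by simp⟩⟩

theorem coupling_of_lift {S : Type u} {R : S → S → Prop} {Δ Θ : SubDist S}
    (h : Lift (toPoint R) Δ Θ) : Nonempty (Coupling R Δ Θ) := by
  induction h with
  | base h =>
    obtain ⟨t, h, rfl⟩ := h
    exact Coupling.nonempty_single h
  | @comb n p Δs Θs Δ Θ _ _ hΔ hΘ ih =>
    let C := fun i => (ih i).some
    refine ⟨⟨Σ i : ULift.{u} (Fin n), (C i.down).ι, fun x => p x.1.down * (C x.1.down).weight x.2,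
      fun x => (C x.1.down).fst x.2, fun x => (C x.1.down).snd x.2,
      fun x hx => (C x.1.down).rel x.2 (right_ne_zero_of_mul hx), fun s => ?_, fun s => ?_⟩⟩
    · rw [hΔ, ENNReal.tsum_sigma', tsum_fintype, ← Equiv.ulift.{u}.symm.sum_comp]
      simp_rw [(C _).left, ← ENNReal.tsum_mul_left, mul_assoc]
      rfl
    · rw [hΘ, ENNReal.tsum_sigma', tsum_fintype, ← Equiv.ulift.{u}.symm.sum_comp]
      simp_rw [(C _).right, ← ENNReal.tsum_mul_left, mul_assoc]
      rfl

/-- Compositions, with the same test, of networks related by simulation. -/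
def SimComp (D : Definitions L) (x s : Net L) : Prop :=
  ∃ M N T : Net L, x = M.comp T ∧ s = N.comp T ∧ Sim D M N ∧ Fits M T ∧ Fits N T

/-- Both sides are indexed by a pair of related networks and one common system for the test, so that
the paired compositions share the same test. -/
theorem Coupling.nonempty_compose {Γ : Graph L} {t : Sys L} {ρ : PMF (Sys L)}
    (hρ : ∀ K ∈ ρ.support, K.nodeList = t.nodeList) {m m' : Net L → ℝ≥0∞}
    (C : Coupling (Sim D) m m') (hm : ∀ M, m M ≠ 0 → Fits M ⟨Γ, t⟩)
    (hm' : ∀ N, m' N ≠ 0 → Fits N ⟨Γ, t⟩) :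
    Nonempty (Coupling (SimComp D) (compose Γ m ρ) (compose Γ m' ρ)) := by
  have hC : ∀ {f : C.ι → Net L} {w : Net L → ℝ≥0∞},
      (∀ s, w s = ∑' i, C.weight i * PMF.pure (f i) s) →
      ∀ i, C.weight i ≠ 0 → w (f i) ≠ 0 := fun hw i hi => by
    rw [hw]
    exact fun h => hi (by simpa using ENNReal.tsum_eq_zero.mp h i)
  have hsum : ∀ {f : C.ι → Net L} {w : Net L → ℝ≥0∞},
      (∀ s, w s = ∑' i, C.weight i * PMF.pure (f i) s) → ∀ K, compose Γ w ρ K =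
        ∑' x : C.ι × Sys L, C.weight x.1 * ρ x.2 * PMF.pure ((f x.1).comp ⟨Γ, x.2⟩) K := by
    intro f w hw K
    rw [compose_combination_left hw, ENNReal.tsum_prod']
    refine tsum_congr fun i => ?_
    rw [compose_pure_left, expect, ← ENNReal.tsum_mul_left]
    exact tsum_congr fun t => (mul_assoc _ _ _).symm
  refine ⟨⟨C.ι × Sys L, fun x => C.weight x.1 * ρ x.2, fun x => (C.fst x.1).comp ⟨Γ, x.2⟩,
    fun x => (C.snd x.1).comp ⟨Γ, x.2⟩, fun x hx => ?_, hsum C.left, hsum C.right⟩⟩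
  have h₁ := left_ne_zero_of_mul hx
  have h₂ := hρ x.2 (right_ne_zero_of_mul hx)
  exact ⟨_, _, _, rfl, rfl, C.rel x.1 h₁, (hm _ (hC C.left x.1 h₁)).congr_right h₂,
    (hm' _ (hC C.right x.1 h₁)).congr_right h₂⟩

theorem Weak.shaped {a : EAct L} {N : Net L} {Θ : SubDist (Net L)} (h : Weak D a N Θ) :
    Shaped N Θ := by
  cases a with
  | tau => exact (shaped_point N).hyper h
  | inp n c v =>
    obtain ⟨Δ₁, Δ₂, h₁, h₂, h₃⟩ := h
    exact (((shaped_point N).hyper h₁).step h₂).hyper h₃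
  | out c v η => exact (WeakOut.outEvolves h).1

/-- A strong action on the left, and the weak action that simulates it, in the same context. -/
theorem exists_match {M N : Net L} {Γ : Graph L} {t : Sys L} (hMN : Sim D M N)
    (hM : Fits M ⟨Γ, t⟩) (hN : Fits N ⟨Γ, t⟩) {a : EAct L} {μ : PMF (Net L)} (hμ : EStep D M a μ)
    {ρ : PMF (Sys L)} (hρ : ∀ K ∈ ρ.support, K.nodeList = t.nodeList)
    (hE : ∀ Θ, Weak D a N Θ → Evolves (Red D) (PMF.pure (N.comp ⟨Γ, t⟩)) (compose Γ Θ ρ))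
    {ν : Net L → ℝ≥0∞} (hν : ν = compose Γ μ ρ) :
    ∃ m, Evolves (Red D) (PMF.pure (N.comp ⟨Γ, t⟩)) m ∧
      Nonempty (Coupling (SimComp D) ν m) := by
  obtain ⟨Θ, hw, hl⟩ := hMN.exists_weak hμ
  obtain ⟨C⟩ := coupling_of_lift hl
  subst hν
  exact ⟨_, hE Θ hw, C.nonempty_compose hρ (fun K hK => hM.congr_left (hμ.sameShape hK))
    fun K hK => hw.shaped.fits hN hK⟩

/-- A move of the context alone. -/
theorem exists_match_context {M N : Net L} {Γ : Graph L} {t : Sys L} (hMN : Sim D M N)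
    (hM : Fits M ⟨Γ, t⟩) (hN : Fits N ⟨Γ, t⟩) {ρ : PMF (Sys L)}
    (hρ : ∀ K ∈ ρ.support, K.nodeList = t.nodeList) {ν' : PMF (Net L)}
    (hred : Red D (N.comp ⟨Γ, t⟩) ν') (hν' : ∀ K, ν' K = compose Γ (PMF.pure N) ρ K)
    {ν : Net L → ℝ≥0∞} (hν : ν = compose Γ (PMF.pure M) ρ) :
    ∃ m, Evolves (Red D) (PMF.pure (N.comp ⟨Γ, t⟩)) m ∧
      Nonempty (Coupling (SimComp D) ν m) := by
  obtain ⟨C⟩ := Coupling.nonempty_single hMN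
  subst hν
  refine ⟨ν', .flow (.single hred), ?_⟩
  rw [show (ν' : Net L → ℝ≥0∞) = compose Γ (PMF.pure N) ρ from funext hν']
  refine C.nonempty_compose hρ (fun K hK => ?_) fun K hK => ?_
  · have : K = M := by simpa using hK
    rwa [this]
  · have : K = N := by simpa using hK
    rwa [this]

/-- Four kinds of reduction occur: internal moves and broadcasts, on either side. Those in which `M`
takes part give extensional actions of `M`, since it is unsuccessful; those that do not affect `M`
are repeated with `N`. -/
theorem simComp_step {M N : Net L} {Γ : Graph L} {t : Sys L} (hMN : Sim D M N)
    (hM : Fits M ⟨Γ, t⟩) (hN : Fits N ⟨Γ, t⟩) (hs : ¬ M.Success D) {ν : PMF (Net L)}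
    (hν : Red D (M.comp ⟨Γ, t⟩) ν) :
    ∃ m, Evolves (Red D) (PMF.pure (N.comp ⟨Γ, t⟩)) m ∧
      Nonempty (Coupling (SimComp D) ν m) := by
  obtain ⟨Λ, rfl, ⟨m, h⟩ | ⟨m, c, v, h⟩⟩ := hν
  · cases h with
    | tauPropL _ h =>
      refine exists_match hMN hM hN (.tau hs (hM.iStep_left_iff.mp h))
        (fun K hK => nodeList_of_mem_pure hK) (fun Θ hw => ?_)
        (funext fun K => compose_netD M.graph _ _ K)
      have := Evolves.hyper hN (shaped_point N) hw
      rwa [compose_point_pure] at this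
    | @tauPropR _ _ Δ _ h =>
      have hn : m ∈ t.nodes := h.node_mem trivial
      obtain ⟨ν', hred, hν'⟩ := exists_red_comp (D := D) (N := N) (Γ := Γ) (t := t)
        (Δ := PMF.pure N.sys) (ρ := Δ)
        (.inl ⟨m, .tauPropR _ ((hN.iStep_right_iff (a := .tau m) hn).mpr
          ((hM.iStep_right_iff (a := .tau m) hn).mp h))⟩)
      rw [netD_pure] at hν'
      refine exists_match_context hMN hM hN h.nodeList_eq hred hν' (funext fun K => ?_)
      rw [← netD_pure M]
      exact compose_netD M.graph _ _ K
  · cases h with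
    | @syncL _ _ _ _ _ Δ ρ h h' =>
      have hm : m ∈ M.sys.nodes := h.node_mem trivial
      have hstep := hM.iStep_left_iff.mp h
      have hreact := (hM.iStep_rcv_iff hm).mp h'
      have hcomp : (netD (M.graph.union Γ) (parD Δ ρ) : Net L → ℝ≥0∞) =
        compose Γ (netD M.graph Δ) ρ := funext fun K => compose_netD M.graph _ _ K
      -- With an empty target set the broadcast is no extensional output but internal activity, and
      -- the test does not change.
      by_cases hη : {o ∈ M.outp | M.graph.E m o}.Nonempty
      · exact exists_match hMN hM hN (.out hs hstep rfl hη) h'.nodeList_eq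
          (fun Θ hw => (WeakOut.outEvolves hw).2 Γ t ρ hN hreact) hcomp
      · have hρ : ρ = PMF.pure t := hreact.eq_pure fun n _ hn => hη ⟨n, hn⟩
        subst hρ
        refine exists_match hMN hM hN (.tauBroad hs hstep fun o ho => ?_) h'.nodeList_eq
          (fun Θ hw => ?_) hcomp
        · by_contra hn
          exact hη ⟨o, ⟨⟨M.graph.right_mem m o ho, hn⟩, m, ho⟩, ho⟩
        · have := Evolves.hyper hN (shaped_point N) hw
          rwa [compose_point_pure] at this
    | @syncR _ _ _ _ _ Δ ρ h h' =>
      have hm : m ∈ t.nodes := h'.node_mem trivial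
      have hstep := hM.iStep_left_iff.mp h
      have hcomp : (netD (M.graph.union Γ) (parD Δ ρ) : Net L → ℝ≥0∞) =
        compose Γ (netD M.graph Δ) ρ := funext fun K => compose_netD M.graph _ _ K
      have hsnd : IStep D Γ t (.snd m c v) ρ := (hM.iStep_right_iff (a := .snd m c v) hm).mp h'
      -- A broadcast from outside the input nodes is unnoticed by `M`, and also by `N` because
      -- simulation forces equal inputs.
      by_cases hinp : m ∈ M.inp
      · refine exists_match hMN hM hN (.inp hs hstep hinp) h'.nodeList_eq (fun Θ hw => ?_) hcomp
        obtain ⟨Δ₁, Δ₂, h₁, h₂, h₃⟩ := hw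
        exact Evolves.hyper_step_hyper hN h₁ h₂ h₃ hsnd.nodeList_eq
          fun K μ hK hμ => hK.red_of_inp hμ hsnd
      · have hΔ := (hM.eq_pure_of_notMem_inp hm hinp).mp hstep
        subst hΔ
        obtain ⟨ν', hred, hν'⟩ := exists_red_comp (D := D) (N := N) (Γ := Γ) (t := t)
          (Δ := PMF.pure N.sys) (ρ := ρ)
          (.inr ⟨m, c, v, .syncR (hN.iStep_left_iff.mpr
            ((hN.eq_pure_of_notMem_inp hm (hMN.inp_eq ▸ hinp)).mpr rfl))
            ((hN.iStep_right_iff (a := .snd m c v) hm).mpr hsnd)⟩)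
        rw [netD_pure] at hν'
        rw [netD_pure] at hcomp
        exact exists_match_context hMN hM hN h'.nodeList_eq hred hν' hcomp

/-- If success comes from the network, `N` moves with probability one to successful networks, which
stay successful next to the test. If it comes from the test, `N.comp T` is successful already. -/
theorem simComp_success {M N : Net L} {Γ : Graph L} {t : Sys L} (hMN : Sim D M N)
    (hN : Fits N ⟨Γ, t⟩) (hs : (M.comp ⟨Γ, t⟩).Success D) :
    ∃ m, Evolves (Red D) (PMF.pure (N.comp ⟨Γ, t⟩)) m ∧ ∑' K, m K = 1 ∧
      ∀ K, m K ≠ 0 → K.Success D := by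
  rcases successful_par.mp hs with h | h
  · obtain ⟨R, hR, hMN⟩ := hMN
    obtain ⟨Θ, hfull, hw, hsucc⟩ := hR.success hMN h
    have hE := Evolves.hyper hN (shaped_point N) hw
    rw [compose_point_pure] at hE
    have hc : ∀ K, compose Γ Θ (PMF.pure t) K =
        ∑' N : Net L, Θ N * PMF.pure (N.comp ⟨Γ, t⟩) K := fun K =>
      tsum_congr fun N => congrArg _ (expect_pure _ _)
    refine ⟨_, hE, ?_, fun K hK => ?_⟩
    · have := expect_combination (h := fun _ => 1) hc
      simp_rw [expect_pmf_const, mul_one] at this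
      rw [expect_const, mul_one] at this
      rw [this]
      exact hfull
    · obtain ⟨N', hN', rfl⟩ := exists_weight_ne_zero hc hK
      exact successful_par.mpr (.inl (hsucc N' hN'))
  · refine ⟨_, .refl _, (PMF.pure _).tsum_coe, fun K hK => ?_⟩
    have : K = N.comp ⟨Γ, t⟩ := by simpa using hK
    rw [this]
    exact successful_par.mpr (.inr h)

theorem matching_simComp (D : Definitions L) :
    Matching (Red D) (Net.Success D) (SimComp D) where
  success := by
    rintro x s ⟨M, N, T, rfl, rfl, hMN, hM, hN⟩ hs
    exact simComp_success hMN hN hs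
  step := by
    rintro x s μ ⟨M, N, T, rfl, rfl, hMN, hM, hN⟩ hs hμ
    exact simComp_step hMN hM hN (fun h => hs (successful_par.mpr (.inl h))) hμ

theorem finite_support_of_red {M : Net L} {Λ : PMF (Net L)} (h : Red D M Λ) :
    Λ.support.Finite := by
  obtain ⟨Δ, rfl, ⟨m, h⟩ | ⟨m, c, v, h⟩⟩ := h <;>
    exact (PMF.support_map (Net.mk M.graph) Δ) ▸ h.finite_support.image _

end Simulation

end WNet

end

theorem theorem6p2 (L : WNet.Names) (D : WNet.Definitions L) (N₁ N₂ : WNet.Net L)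
    (hw₁ : N₁.WellFormed) (hw₂ : N₂.WellFormed)
    (hf₁ : WNet.Finitary D N₁) (hf₂ : WNet.Finitary D N₂)
    (hsim : WNet.Sim D N₁ N₂) : WNet.MayLE D N₁ N₂ :=
  ⟨hsim.inp_eq, hsim.outp_eq, fun T hT h₁ h₂ =>
    WNet.Matching.hoareLE (P := WNet.testing D) (fun _ _ h => WNet.finite_support_of_red h)
      (WNet.matching_simComp D) ⟨N₁, N₂, T, rfl, rfl, hsim, ⟨hw₁, hT, h₁⟩, ⟨hw₂, hT, h₂⟩⟩⟩
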